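/- Let $\mathcal X_0\in\mathbb C^{M_1\times\cdots\times M_R\times N}$ be a noise-free tensor, $\mathcal X=\mathcal X_0+\mathcal N$ its noisy observation, and $\Delta=\|\mathcal N\|_F$ the norm of the noise. Write $[\cdot]_{(r)}$ for the $r$-mode unfolding, $X_0=[\mathcal X_0]_{(R+1)}^T$, $X=[\mathcal X]_{(R+1)}^T$, $N=[\mathcal N]_{(R+1)}^T$ (matrices of size $M\times N$ with $M=\prod_r M_r$), $N_{(r)}=[\mathcal N]_{(r)}$, $d=\operatorname{rank}X_0$ and $p_r=\operatorname{rank}[\mathcal X_0]_{(r)}$. Noise-free SVDs: let $X_0=U_s\Sigma_sV_s^H$ and $[\mathcal X_0]_{(r)}=U_r^{[s]}\Sigma_r^{[s]}V_r^{[s]H}$ $(r\le R)$ be SVDs, with $\Sigma_s=\operatorname{diag}(\sigma_1,\dots,\sigma_d)$ and $\Sigma_r^{[s]}\in\mathbb R^{p_r\times p_r}$ containing the nonzero singular values in non-increasing order; let the columns of $U_n$, $U_r^{[n]}$ complete those of $U_s$, $U_r^{[s]}$ to orthonormal bases, and put $T_r=U_r^{[s]}U_r^{[s]H}$. Assume that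 $\sigma_1,\dots,\sigma_d$ are distinct. Estimates: let $\mathcal X=\hat{\mathcal S}\times_1\hat U_1\cdots\times_{R+1}\hat U_{R+1}$ be an HOSVD, where $\hat U_r$ is the unitary matrix of left singular vectors of $[\mathcal X]_{(r)}$ for $r\le R$ and, for an SVD $X=\hat U\hat\Sigma\hat V^H$, $\hat U_{R+1}$ is the complex conjugate of $\hat V$ (all singular values ordered non-increasingly). Let $\hat U_r^{[s]}$ be the first $p_r$ columns of $\hat U_r$, $\hat U_s$ the first $d$ columns of $\hat U$, $\hat\Sigma_s$ the diagonal matrix of the $d$ largest singular values of $X$, and $\hat{\mathcal S}^{[s]}$ the leading $p_1\times\cdots\times p_R\times d$ block of the core tensor $\hat{\mathcal S}$. The phases are chosen so that $u_k^H\hat u_k\ge 0$ for corresponding columns $u_k,\hat u_k$ of $U_s,\hat U_s$, $k\le d$. The HOSVD-based signal subspace estimate is $[\hat{\mathcal U}^{[s]}]_{(R+1)}^T$ with $$\hat{\mathcal U}^{[s]}=\hat{\mathcal S}^{[s]}\times_1\hat U_1^{[s]}\cdots\times_R\hat U_R^{[s]}\times_{R+1}\hat\Sigma_s^{-1}.$$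 Theorem. As $\Delta\to0$, $$[\hat{\mathcal U}^{[s]}]_{(R+1)}^T=U_s+(T_1\otimes\cdots\otimes T_R)\,\Delta U_s+\sum_{r=1}^R\bigl(T_1\otimes\cdots\otimes[\Delta U_r^{[s]}U_r^{[s]H}]\otimes\cdots\otimes T_R\bigr)U_s+O(\Delta^2),$$ where in the $r$-th summand $T_r$ is replaced by $\Delta U_r^{[s]}U_r^{[s]H}$, $$\Delta U_r^{[s]}=U_r^{[n]}U_r^{[n]H}N_{(r)}V_r^{[s]}\bigl(\Sigma_r^{[s]}\bigr)^{-1},$$ and $\Delta U_s=\hat U_s-U_s$ has the expansion $$\Delta U_s=U_nU_n^HNV_s\Sigma_s^{-1}+U_s\Gamma_s+O(\Delta^2),\qquad \Gamma_s=D\odot\bigl(U_s^HNV_s\Sigma_s+\Sigma_sV_s^HN^HU_s\bigr),$$ with $D_{k\ell}=1/(\sigma_\ell^2-\sigma_k^2)$ for $k\ne\ell$ and $D_{kk}=0$. The constants in $O(\Delta^2)$ depend only on $\mathcal X_0$ and its chosen SVDs, not on the noise or on the choice of the HOSVD of $\mathcal X$. -/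

import Mathlib

open scoped Matrix

-- The norm of a matrix is the Frobenius norm throughout.
attribute [local instance] Matrix.frobeniusNormedAddCommGroup

/-! Tensors with `R` "spatial" modes and one further, `(R+1)`-st mode ("snapshots"). -/

/-- A complex `(R+1)`-way tensor: mode `r ≤ R` is indexed by `I r`, mode `R+1` by `K`. -/
abbrev Tensor {R : ℕ} (I : Fin R → Type) (K : Type) : Type := (∀ r, I r) → K → ℂ

namespace Tensor

variable {R : ℕ} {I J : Fin R → Type} {K L : Type}

/-- The transposed `(R+1)`-mode unfolding `[X]_(R+1)ᵀ`: the spatial modes are stacked along the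
rows (row index: the multi-index `(i_1, …, i_R)`), the last mode runs along the columns. -/
def lastUnfoldT (X : Tensor I K) : Matrix (∀ r, I r) K ℂ := Matrix.of X

/-- The `r`-mode unfolding `[X]_(r)` for a spatial mode `r`; its columns, the `r`-mode vectors of
`X`, are indexed by the values of all the other indices. -/
def unfold (X : Tensor I K) (r : Fin R) :
    Matrix (I r) ((∀ s : {s // s ≠ r}, I s) × K) ℂ :=
  Matrix.of fun i c => X ((Equiv.piSplitAt r I).symm (i, c.1)) c.2

/-- The multi-mode product `X ×_1 U_1 ×_2 U_2 ⋯ ×_R U_R ×_{R+1} W`. -/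
noncomputable def modeMul [∀ r, Fintype (I r)] [Fintype K] (X : Tensor I K)
    (U : ∀ r, Matrix (J r) (I r) ℂ) (W : Matrix L K ℂ) : Tensor J L :=
  fun j l => ∑ i : (∀ r, I r), ∑ k : K, (∏ r, U r (j r) (i r)) * W l k * X i k

/-- The `r`-rank of `X`: the rank of its `r`-mode unfolding. -/
noncomputable def modeRank [∀ r, Fintype (I r)] [Fintype K] (X : Tensor I K) (r : Fin R) : ℕ :=
  (X.unfold r).rank

end Tensor

/-- The Kronecker product `T_1 ⊗ T_2 ⊗ ⋯ ⊗ T_R`, rows and columns indexed by multi-indices. -/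
def kroneckerAll {R : ℕ} {I J : Fin R → Type} (T : ∀ r, Matrix (J r) (I r) ℂ) :
    Matrix (∀ r, J r) (∀ r, I r) ℂ :=
  Matrix.of fun j i => ∏ r, T r (j r) (i r)

/-- A singular value decomposition
`A = [Us Un] * [[Σs, 0], [0, Σn]] * [Vs Vn]ᴴ` of an `m × n` matrix, split after the `p` dominant
singular values (signal part: the first `p`, noise part: the others). -/
structure SVD {m n : Type} [Fintype m] [Fintype n] [DecidableEq m] [DecidableEq n]
    (A : Matrix m n ℂ) (p : ℕ) where
  /-- dominant left singular vectors -/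
  Us : Matrix m (Fin p) ℂ
  /-- remaining left singular vectors -/
  Un : Matrix m (Fin (Fintype.card m - p)) ℂ
  /-- dominant right singular vectors -/
  Vs : Matrix n (Fin p) ℂ
  /-- remaining right singular vectors -/
  Vn : Matrix n (Fin (Fintype.card n - p)) ℂ
  /-- the singular values in non-increasing order, continued by zeros -/
  σ : ℕ → ℝ
  U_conj_mul : (Matrix.fromCols Us Un)ᴴ * Matrix.fromCols Us Un = 1
  U_mul_conj : Matrix.fromCols Us Un * (Matrix.fromCols Us Un)ᴴ = 1
  V_conj_mul : (Matrix.fromCols Vs Vn)ᴴ * Matrix.fromCols Vs Vn = 1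
  V_mul_conj : Matrix.fromCols Vs Vn * (Matrix.fromCols Vs Vn)ᴴ = 1
  σ_nonneg : ∀ k, 0 ≤ σ k
  σ_antitone : Antitone σ
  σ_zero : ∀ k, min (Fintype.card m) (Fintype.card n) ≤ k → σ k = 0
  eq_mul : A = Matrix.fromCols Us Un *
    Matrix.fromBlocks (Matrix.diagonal fun k : Fin p => (σ k : ℂ)) 0 0
      (Matrix.of fun (i : Fin (Fintype.card m - p)) (j : Fin (Fintype.card n - p)) =>
        if (i : ℕ) = (j : ℕ) then (σ (p + i) : ℂ) else 0) *
    (Matrix.fromCols Vs Vn)ᴴ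

namespace SVD

variable {m n : Type} [Fintype m] [Fintype n] [DecidableEq m] [DecidableEq n]
  {A : Matrix m n ℂ} {p : ℕ}

/-- The diagonal matrix `Σs` of the `p` dominant singular values. -/
noncomputable def Sig (D : SVD A p) : Matrix (Fin p) (Fin p) ℂ :=
  Matrix.diagonal fun k => (D.σ k : ℂ)

/-- The whole unitary matrix `[Us Un]` of left singular vectors. -/
def U (D : SVD A p) : Matrix m (Fin p ⊕ Fin (Fintype.card m - p)) ℂ :=
  Matrix.fromCols D.Us D.Un

/-- The whole unitary matrix `[Vs Vn]` of right singular vectors. -/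
def V (D : SVD A p) : Matrix n (Fin p ⊕ Fin (Fintype.card n - p)) ℂ :=
  Matrix.fromCols D.Vs D.Vn

/-- The projection `Us * Usᴴ` onto the span of the dominant left singular vectors. -/
noncomputable def T (D : SVD A p) : Matrix m m ℂ := D.Us * D.Usᴴ

/-- `Γn = Unᴴ * E * Vs * Σs⁻¹` for a perturbation `E` of `A`. -/
noncomputable def Γn (D : SVD A p) (E : Matrix m n ℂ) :
    Matrix (Fin (Fintype.card m - p)) (Fin p) ℂ :=
  D.Unᴴ * E * D.Vs * D.Sig⁻¹

/-- `Γs = D ⊙ (Usᴴ * E * Vs * Σs + Σs * Vsᴴ * Eᴴ * Us)`, where the matrix `D` has the entries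
`1 / (σ_l ^ 2 - σ_k ^ 2)` for `k ≠ l` and zeros on its diagonal. -/
noncomputable def Γs (D : SVD A p) (E : Matrix m n ℂ) : Matrix (Fin p) (Fin p) ℂ :=
  Matrix.hadamard
    (Matrix.of fun k l => if k = l then 0 else 1 / ((D.σ l : ℂ) ^ 2 - (D.σ k : ℂ) ^ 2))
    (D.Usᴴ * E * D.Vs * D.Sig + D.Sig * D.Vsᴴ * Eᴴ * D.Us)

end SVD

/-- A higher-order SVD `X = S ×_1 U_1 ⋯ ×_R U_R ×_{R+1} U_{R+1}` of a tensor `X`, truncated to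
`p r` dominant singular vectors in mode `r ≤ R` and to `d` ones in mode `R+1`. For `r ≤ R`, `U_r` is
the unitary matrix of left singular vectors of `[X]_(r)`. In the last mode, an SVD
`[X]_(R+1)ᵀ = U * Σ * Vᴴ` gives the SVD `[X]_(R+1) = conj V * Σᵀ * (conj U)ᴴ`, so that
`U_{R+1} = conj V`. (The core tensor `S` is determined by `X` and the unitary matrices `U_r`, and
its all-orthogonality is automatic.) -/
structure HOSVD {R : ℕ} {I : Fin R → Type} {K : Type} [∀ r, Fintype (I r)]
    [∀ r, DecidableEq (I r)] [Fintype K] [DecidableEq K]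
    (X : Tensor I K) (p : Fin R → ℕ) (d : ℕ) where
  /-- the SVDs of the unfoldings `[X]_(r)`, `r ≤ R` -/
  mode : ∀ r, SVD (X.unfold r) (p r)
  /-- the SVD of `[X]_(R+1)ᵀ` -/
  last : SVD X.lastUnfoldT d
  /-- the (full) core tensor -/
  core : Tensor (fun r => Fin (p r) ⊕ Fin (Fintype.card (I r) - p r))
    (Fin d ⊕ Fin (Fintype.card K - d))
  eq_modeMul : X = core.modeMul (fun r => (mode r).U) (last.V.map star)

namespace HOSVD

variable {R : ℕ} {I : Fin R → Type} {K : Type} [∀ r, Fintype (I r)]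
  [∀ r, DecidableEq (I r)] [Fintype K] [DecidableEq K]
  {X : Tensor I K} {p : Fin R → ℕ} {d : ℕ}

/-- The truncated core tensor: the leading `p 1 × ⋯ × p R × d` block of the core tensor. -/
def truncCore (H : HOSVD X p d) : Tensor (fun r => Fin (p r)) (Fin d) :=
  fun a k => H.core (fun r => Sum.inl (a r)) (Sum.inl k)

/-- The HOSVD-based signal subspace tensor `S^[s] ×_1 U_1^[s] ⋯ ×_R U_R^[s] ×_{R+1} Σs⁻¹`. -/
noncomputable def subspaceTensor (H : HOSVD X p d) : Tensor I (Fin d) :=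
  H.truncCore.modeMul (fun r => (H.mode r).Us) H.last.Sig⁻¹

end HOSVD

/-!
Write hats for the quantities of the noisy data, `T = Us * Usᴴ` for the signal projection of an
unfolding `A₀`, `Q = 1 - T`, and `E = A - A₀`.

*Signal projections.* Weyl's inequality for `A * Aᴴ` (`SVD.abs_sq_sub_sq_le`) shows that the squared
dominant singular values move by `O(Δ)`, so they stay away from `0` for small noise
(`SVD.exists_gap`). Since `Q * A₀ = 0`, we have `Q * Ûs = Q * E * V̂s * Σ̂s⁻¹ = O(Δ)`, and because
`T` and `T̂` have the same rank also `(1 - T̂) * Us = O(Δ)`. Of the four blocks of `T̂` cut out by `T`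
and `Q`, the diagonal ones agree with those of `T` up to `O(Δ²)`, and the others are to
first order `Q * E * Vs * Σs⁻¹ * Usᴴ` and its adjoint (`SVD.IsPerturbation.T_expansion`).

*Singular vectors.* The overlap `P = Usᴴ * Ûs` satisfies the Sylvester equation
`P k l * (σ̂ l ^ 2 - σ k ^ 2) = (Usᴴ * (A * Aᴴ - A₀ * A₀ᴴ) * Ûs) k l`. As the singular values are
distinct, it determines the off-diagonal entries of `P` to first order, while unit length and phase
alignment give `P k k = 1 + O(Δ²)`; this is where `Γs` comes from
(`SVD.IsPerturbation.Us_expansion`).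

*The HOSVD-based estimate.* The estimate equals `(T̂ 1 ⊗ ⋯ ⊗ T̂ R) * Ûs`
(`HOSVD.lastUnfoldT_subspaceTensor`). The product rule expands the Kronecker product. The adjoint
part of each first-order term has `Q r` as its last factor, so it annihilates `Us`, whose
columns are combinations of signals lying in the range of `T r` in mode `r`.

All estimates are stated as `O(·)` along a filter on an arbitrary family of perturbations. The
constant is uniform because the theorem takes the trivial filter `⊤` on the family of all admissible
noise tensors and HOSVDs.
-/

/-! ### The Frobenius norm -/

section Frobenius

variable {l m n : Type*} [Fintype l] [Fintype m] [Fintype n]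

theorem frobenius_norm_sq (A : Matrix m n ℂ) : ‖A‖ ^ 2 = ∑ i, ∑ j, ‖A i j‖ ^ 2 := by
  rw [Matrix.frobenius_norm_def, ← Real.sqrt_eq_rpow, Real.sq_sqrt (by positivity)]
  norm_cast

theorem frobenius_norm_sq_eq_trace (A : Matrix m n ℂ) : ‖A‖ ^ 2 = (Aᴴ * A).trace.re := by
  rw [frobenius_norm_sq, Finset.sum_comm]
  simp [Matrix.trace, Matrix.mul_apply, Complex.sq_norm, Complex.normSq_apply]

theorem frobenius_norm_apply_le (A : Matrix m n ℂ) (i : m) (j : n) : ‖A i j‖ ≤ ‖A‖ := by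
  refine le_of_sq_le_sq ?_ (norm_nonneg _)
  rw [frobenius_norm_sq]
  exact (Finset.single_le_sum (f := fun j => ‖A i j‖ ^ 2) (fun _ _ => by positivity)
    (Finset.mem_univ j)).trans (Finset.single_le_sum (f := fun i => ∑ j, ‖A i j‖ ^ 2)
      (fun _ _ => by positivity) (Finset.mem_univ i))

theorem frobenius_norm_isometry_mul [DecidableEq n] {V : Matrix m n ℂ} (hV : Vᴴ * V = 1)
    (A : Matrix n l ℂ) : ‖V * A‖ = ‖A‖ := by
  rw [← sq_eq_sq₀ (norm_nonneg _) (norm_nonneg _), frobenius_norm_sq_eq_trace,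
    frobenius_norm_sq_eq_trace, Matrix.conjTranspose_mul, Matrix.mul_assoc, ← Matrix.mul_assoc Vᴴ,
    hV, Matrix.one_mul]

/-- Two orthogonal projections `U * Uᴴ`, `V * Vᴴ` of the same rank: each leaks equally much out of
the range of the other. -/
theorem frobenius_norm_compl_mul_comm [DecidableEq m] [DecidableEq n] {U V : Matrix m n ℂ}
    (hU : Uᴴ * U = 1) (hV : Vᴴ * V = 1) :
    ‖(1 - U * Uᴴ) * V‖ = ‖(1 - V * Vᴴ) * U‖ := by
  have key : ∀ {U V : Matrix m n ℂ}, Uᴴ * U = 1 → Vᴴ * V = 1 →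
      ‖(1 - U * Uᴴ) * V‖ ^ 2 = (1 : Matrix n n ℂ).trace.re - ‖Uᴴ * V‖ ^ 2 := by
    intro U V hU hV
    rw [frobenius_norm_sq_eq_trace, frobenius_norm_sq_eq_trace, ← Complex.sub_re,
      ← Matrix.trace_sub]
    congr 2
    have h1 : U * Uᴴ * (U * Uᴴ) = U * Uᴴ := by
      rw [Matrix.mul_assoc, ← Matrix.mul_assoc Uᴴ, hU, Matrix.one_mul]
    have h2 : ((1 : Matrix m m ℂ) - U * Uᴴ) * (1 - U * Uᴴ) = 1 - U * Uᴴ := by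
      rw [Matrix.mul_sub, Matrix.mul_one, Matrix.sub_mul, Matrix.one_mul, h1]; simp
    calc ((1 - U * Uᴴ) * V)ᴴ * ((1 - U * Uᴴ) * V)
        = Vᴴ * (((1 : Matrix m m ℂ) - U * Uᴴ) * (1 - U * Uᴴ)) * V := by
          simp [Matrix.conjTranspose_mul, Matrix.mul_assoc]
      _ = 1 - (Uᴴ * V)ᴴ * (Uᴴ * V) := by
          rw [h2, Matrix.mul_sub, Matrix.sub_mul, Matrix.mul_one, hV]
          simp [Matrix.conjTranspose_mul, Matrix.mul_assoc]
  rw [← sq_eq_sq₀ (norm_nonneg _) (norm_nonneg _), key hU hV, key hV hU,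
    ← Matrix.frobenius_norm_conjTranspose (Uᴴ * V)]
  simp

end Frobenius

/-! ### Weyl's inequality -/

/-- Weyl's perturbation inequality for the eigenvalues of Hermitian matrices. The eigenbases `U`,
`V` are indexed by an arbitrary type `J`, and `ι` gives the position of an eigenvalue in the
non-increasing order. -/
theorem weyl_sub_le {n J : Type*} [Fintype n] [Fintype J] [DecidableEq n] [DecidableEq J]
    {ι : J → ℕ} {U V : Matrix n J ℂ} (hU : U * Uᴴ = 1) (hV : Vᴴ * V = 1)
    {a b : ℕ → ℝ} (ha : Antitone a) (hb : Antitone b) (k : J) :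
    b (ι k) - a (ι k) ≤ ‖V * Matrix.diagonal (fun j => (b (ι j) : ℂ)) * Vᴴ -
      U * Matrix.diagonal (fun j => (a (ι j) : ℂ)) * Uᴴ‖ := by
  set F := V * Matrix.diagonal (fun j => (b (ι j) : ℂ)) * Vᴴ -
      U * Matrix.diagonal (fun j => (a (ι j) : ℂ)) * Uᴴ with hF
  set W := Uᴴ * V with hW
  -- `Z x = 0` says that `V x` lies in the span of the first `k + 1` columns of `V` and is
  -- orthogonal to the first `k` columns of `U`. Its `k`-th row is free, hence zero.
  let Z : Matrix J J ℂ := Matrix.of fun i j =>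
    if i = k then 0 else if ι i < ι k then W i j else (1 : Matrix J J ℂ) i j
  obtain ⟨x, hx0, hx⟩ : ∃ x ≠ 0, Z *ᵥ x = 0 :=
    Matrix.exists_mulVec_eq_zero_iff.2
      (Matrix.det_eq_zero_of_row_eq_zero k fun j => by simp [Z])
  let X : Matrix J Unit ℂ := Matrix.of fun j _ => x j
  have h1 : ∀ j, ι k < ι j → X j () = 0 := by
    intro j hj
    have := congrFun hx j
    have hjk : j ≠ k := by rintro rfl; exact lt_irrefl _ hj
    simpa [Z, Matrix.mulVec, dotProduct, hjk, hj.not_gt, Matrix.one_apply, X] using this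
  have h2 : ∀ j, ι j < ι k → (W * X) j () = 0 := by
    intro j hj
    have := congrFun hx j
    have hjk : j ≠ k := by rintro rfl; exact lt_irrefl _ hj
    simpa [Z, Matrix.mulVec, dotProduct, hjk, hj, Matrix.mul_apply, X] using this
  have hdiag : ∀ (w : ℕ → ℝ) (Y : Matrix J Unit ℂ),
      ((Yᴴ * Matrix.diagonal (fun j => (w (ι j) : ℂ)) * Y) () ()).re =
        ∑ j, w (ι j) * ‖Y j ()‖ ^ 2 := by
    intro w Y
    rw [Matrix.mul_apply, Complex.re_sum]
    refine Finset.sum_congr rfl fun j _ => ?_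
    simp [Matrix.mul_diagonal, Complex.sq_norm, Complex.normSq_apply]
    ring
  have hnorm : ∀ Y : Matrix J Unit ℂ, ‖Y‖ ^ 2 = ∑ j, ‖Y j ()‖ ^ 2 := fun Y => by
    simp [frobenius_norm_sq]
  have hWW : Wᴴ * W = 1 := by
    rw [hW, Matrix.conjTranspose_mul, Matrix.conjTranspose_conjTranspose, Matrix.mul_assoc,
      ← Matrix.mul_assoc U, hU, Matrix.one_mul, hV]
  have hWX : ‖W * X‖ = ‖X‖ := frobenius_norm_isometry_mul hWW X
  have hquad : (V * X)ᴴ * F * (V * X) =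
      Xᴴ * Matrix.diagonal (fun j => (b (ι j) : ℂ)) * X -
        (W * X)ᴴ * Matrix.diagonal (fun j => (a (ι j) : ℂ)) * (W * X) := by
    have e2 : ∀ M : Matrix Unit J ℂ, M * Vᴴ * V = M := fun M => by
      rw [Matrix.mul_assoc, hV, Matrix.mul_one]
    simp only [hF, hW, Matrix.mul_sub, Matrix.sub_mul, Matrix.conjTranspose_mul,
      Matrix.conjTranspose_conjTranspose]
    simp only [← Matrix.mul_assoc, e2]
  have hle : (((V * X)ᴴ * F * (V * X)) () ()).re ≤ ‖F‖ * ‖X‖ ^ 2 := by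
    calc _ ≤ ‖((V * X)ᴴ * F * (V * X)) () ()‖ := Complex.re_le_norm _
      _ ≤ ‖(V * X)ᴴ * F * (V * X)‖ := frobenius_norm_apply_le _ _ _
      _ ≤ ‖(V * X)ᴴ‖ * ‖F‖ * ‖V * X‖ := (Matrix.frobenius_norm_mul _ _).trans
          (mul_le_mul_of_nonneg_right (Matrix.frobenius_norm_mul _ _) (norm_nonneg _))
      _ = ‖F‖ * ‖X‖ ^ 2 := by
          rw [Matrix.frobenius_norm_conjTranspose, frobenius_norm_isometry_mul hV]; ring
  have hge : (b (ι k) - a (ι k)) * ‖X‖ ^ 2 ≤ (((V * X)ᴴ * F * (V * X)) () ()).re := by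
    rw [hquad, Matrix.sub_apply, Complex.sub_re, hdiag, hdiag, sub_mul]
    refine sub_le_sub ?_ ?_
    · rw [hnorm, Finset.mul_sum]
      refine Finset.sum_le_sum fun j _ => ?_
      rcases le_or_gt (ι j) (ι k) with h | h
      · exact mul_le_mul_of_nonneg_right (hb h) (by positivity)
      · simp [h1 j h]
    · rw [← hWX, hnorm, Finset.mul_sum]
      refine Finset.sum_le_sum fun j _ => ?_
      rcases lt_or_ge (ι j) (ι k) with h | h
      · simp [h2 j h]
      · exact mul_le_mul_of_nonneg_right (ha h) (by positivity)
  have hX : 0 < ‖X‖ ^ 2 := by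
    refine pow_pos (norm_pos_iff.2 fun h => hx0 ?_) 2
    ext j
    exact congrFun (congrFun h j) ()
  exact le_of_mul_le_mul_right (hge.trans hle) hX

/-! ### Singular value decompositions -/

namespace SVD

variable {m n : Type} [Fintype m] [Fintype n] [DecidableEq m] [DecidableEq n]
  {A : Matrix m n ℂ} {p : ℕ}

/-- The position in the order of all singular vectors of a signal vector (first summand) or a noise
vector (second summand). -/
def pos {p q : ℕ} : Fin p ⊕ Fin q → ℕ := Sum.elim (fun i => i) fun j => p + j

theorem U_blocks (D : SVD A p) : Matrix.fromBlocks (D.Usᴴ * D.Us) (D.Usᴴ * D.Un)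
    (D.Unᴴ * D.Us) (D.Unᴴ * D.Un) = Matrix.fromBlocks 1 0 0 1 := by
  have := D.U_conj_mul
  rwa [Matrix.conjTranspose_fromCols_eq_fromRows_conjTranspose, Matrix.fromRows_mul_fromCols,
    ← Matrix.fromBlocks_one] at this

theorem V_blocks (D : SVD A p) : Matrix.fromBlocks (D.Vsᴴ * D.Vs) (D.Vsᴴ * D.Vn)
    (D.Vnᴴ * D.Vs) (D.Vnᴴ * D.Vn) = Matrix.fromBlocks 1 0 0 1 := by
  have := D.V_conj_mul
  rwa [Matrix.conjTranspose_fromCols_eq_fromRows_conjTranspose, Matrix.fromRows_mul_fromCols,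
    ← Matrix.fromBlocks_one] at this

theorem Us_conj_mul_Us (D : SVD A p) : D.Usᴴ * D.Us = 1 := (Matrix.fromBlocks_inj.1 D.U_blocks).1

theorem Us_conj_mul_Un (D : SVD A p) : D.Usᴴ * D.Un = 0 :=
  (Matrix.fromBlocks_inj.1 D.U_blocks).2.1

theorem Un_conj_mul_Us (D : SVD A p) : D.Unᴴ * D.Us = 0 :=
  (Matrix.fromBlocks_inj.1 D.U_blocks).2.2.1

theorem Vs_conj_mul_Vs (D : SVD A p) : D.Vsᴴ * D.Vs = 1 := (Matrix.fromBlocks_inj.1 D.V_blocks).1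

theorem Vn_conj_mul_Vs (D : SVD A p) : D.Vnᴴ * D.Vs = 0 :=
  (Matrix.fromBlocks_inj.1 D.V_blocks).2.2.1

theorem Un_mul_conj (D : SVD A p) : D.Un * D.Unᴴ = 1 - D.T := by
  have := D.U_mul_conj
  rw [Matrix.conjTranspose_fromCols_eq_fromRows_conjTranspose, Matrix.fromCols_mul_fromRows] at this
  rw [← this, T, add_sub_cancel_left]

theorem T_conjTranspose (D : SVD A p) : D.Tᴴ = D.T := by simp [T, Matrix.conjTranspose_mul]

theorem T_mul_Us (D : SVD A p) : D.T * D.Us = D.Us := by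
  rw [T, Matrix.mul_assoc, Us_conj_mul_Us, Matrix.mul_one]

theorem T_mul_T (D : SVD A p) : D.T * D.T = D.T := by
  nth_rw 2 [T]
  rw [← Matrix.mul_assoc, T_mul_Us, T]

theorem Sig_conjTranspose (D : SVD A p) : D.Sigᴴ = D.Sig := by
  rw [Sig, Matrix.diagonal_conjTranspose]
  congr 1
  ext k
  simp

/-- The block of `Uᴴ * A * V` of the remaining singular values. -/
noncomputable def Sn (D : SVD A p) :
    Matrix (Fin (Fintype.card m - p)) (Fin (Fintype.card n - p)) ℂ :=
  Matrix.of fun i j => if (i : ℕ) = (j : ℕ) then (D.σ (p + i) : ℂ) else 0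

theorem eq_add (D : SVD A p) : A = D.Us * D.Sig * D.Vsᴴ + D.Un * D.Sn * D.Vnᴴ := by
  conv_lhs => rw [D.eq_mul]
  rw [Matrix.conjTranspose_fromCols_eq_fromRows_conjTranspose, Matrix.fromCols_mul_fromBlocks,
    Matrix.fromCols_mul_fromRows]
  simp [Sig, Sn]

theorem mul_Vs (D : SVD A p) : A * D.Vs = D.Us * D.Sig := by
  refine (congrArg (fun B => B * D.Vs) D.eq_add).trans ?_
  rw [Matrix.add_mul, Matrix.mul_assoc, Matrix.mul_assoc (D.Un * D.Sn), Vs_conj_mul_Vs,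
    Vn_conj_mul_Vs]
  simp

theorem conjTranspose_mul_Us (D : SVD A p) : Aᴴ * D.Us = D.Vs * D.Sig := by
  refine (congrArg (fun B => Bᴴ * D.Us) D.eq_add).trans ?_
  simp only [Matrix.conjTranspose_add, Matrix.conjTranspose_mul, Matrix.conjTranspose_conjTranspose,
    Matrix.add_mul, Matrix.mul_assoc, Us_conj_mul_Us, Un_conj_mul_Us, Sig_conjTranspose]
  simp

theorem Us_conj_mul (D : SVD A p) : D.Usᴴ * A = D.Sig * D.Vsᴴ := by
  have := congrArg Matrix.conjTranspose D.conjTranspose_mul_Us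
  simpa [Matrix.conjTranspose_mul, D.Sig_conjTranspose] using this

theorem gram_mul_Us (D : SVD A p) : A * Aᴴ * D.Us = D.Us * D.Sig * D.Sig := by
  rw [Matrix.mul_assoc, conjTranspose_mul_Us, ← Matrix.mul_assoc, mul_Vs]

theorem Us_conj_mul_gram (D : SVD A p) : D.Usᴴ * (A * Aᴴ) = D.Sig * D.Sig * D.Usᴴ := by
  have := congrArg Matrix.conjTranspose D.gram_mul_Us
  simpa [Matrix.conjTranspose_mul, D.Sig_conjTranspose, Matrix.mul_assoc] using this

theorem Sn_mul_conj (D : SVD A p) :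
    D.Sn * D.Snᴴ = Matrix.diagonal fun i : Fin (Fintype.card m - p) =>
      ((D.σ (p + i) ^ 2 : ℝ) : ℂ) := by
  ext i i'
  rw [Matrix.mul_apply]
  by_cases hi : (i : ℕ) < Fintype.card n - p
  · rw [Finset.sum_eq_single ⟨i, hi⟩]
    · by_cases h : i = i'
      · subst h; simp [Sn]; ring
      · have : (i' : ℕ) ≠ i := fun h' => h (Fin.ext h').symm
        simp [Sn, h, this]
    · intro j _ hj
      have : (i : ℕ) ≠ j := fun h' => hj (Fin.ext h'.symm)
      simp [Sn, this]
    · simp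
  · -- beyond the last column, the sequence of singular values is continued by zeros
    have hz : D.σ (p + i) = 0 := D.σ_zero _ (by omega)
    simp [Sn, Matrix.diagonal_apply, hz]

theorem gram_eq (D : SVD A p) :
    A * Aᴴ = D.U * Matrix.diagonal (fun j : Fin p ⊕ Fin (Fintype.card m - p) =>
      ((D.σ (pos j) ^ 2 : ℝ) : ℂ)) * D.Uᴴ := by
  have hd : Matrix.diagonal (fun j : Fin p ⊕ Fin (Fintype.card m - p) =>
      ((D.σ (pos j) ^ 2 : ℝ) : ℂ)) = Matrix.fromBlocks (D.Sig * D.Sig) 0 0 (D.Sn * D.Snᴴ) := by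
    rw [Sn_mul_conj, Sig, Matrix.diagonal_mul_diagonal, Matrix.fromBlocks_diagonal]
    congr 1
    ext (i | i) <;> simp [pos, sq]
  have hn : Aᴴ * D.Un = D.Vn * D.Snᴴ := by
    refine (congrArg (fun B => Bᴴ * D.Un) D.eq_add).trans ?_
    have h1 : D.Unᴴ * D.Un = 1 := (Matrix.fromBlocks_inj.1 D.U_blocks).2.2.2
    simp only [Matrix.conjTranspose_add, Matrix.conjTranspose_mul,
      Matrix.conjTranspose_conjTranspose, Matrix.add_mul, Matrix.mul_assoc, Us_conj_mul_Un, h1]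
    simp
  have hvn : A * D.Vn = D.Un * D.Sn := by
    refine (congrArg (fun B => B * D.Vn) D.eq_add).trans ?_
    have h1 : D.Vnᴴ * D.Vn = 1 := (Matrix.fromBlocks_inj.1 D.V_blocks).2.2.2
    have h2 : D.Vsᴴ * D.Vn = 0 := (Matrix.fromBlocks_inj.1 D.V_blocks).2.1
    simp only [Matrix.add_mul, Matrix.mul_assoc, h1, h2]
    simp
  have key : A * Aᴴ * D.U = D.U * Matrix.diagonal (fun j : Fin p ⊕ Fin (Fintype.card m - p) =>
      ((D.σ (pos j) ^ 2 : ℝ) : ℂ)) := by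
    rw [hd, U, Matrix.mul_fromCols, Matrix.fromCols_mul_fromBlocks, gram_mul_Us, Matrix.mul_assoc A,
      hn, ← Matrix.mul_assoc A, hvn]
    simp [Matrix.mul_assoc]
  rw [← key, Matrix.mul_assoc, show D.U * D.Uᴴ = 1 from D.U_mul_conj, Matrix.mul_one]

/-- The squared singular values depend on the matrix in a Lipschitz way. -/
theorem abs_sq_sub_sq_le {B : Matrix m n ℂ} (D : SVD A p) (D' : SVD B p) (k : Fin p) :
    |D'.σ k ^ 2 - D.σ k ^ 2| ≤ ‖B * Bᴴ - A * Aᴴ‖ := by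
  have anti : ∀ {B : Matrix m n ℂ} (D : SVD B p), Antitone fun k => D.σ k ^ 2 :=
    fun D i j h => pow_le_pow_left₀ (D.σ_nonneg _) (D.σ_antitone h) 2
  rw [abs_sub_le_iff]
  constructor
  · have := weyl_sub_le (ι := pos) D.U_mul_conj D'.U_conj_mul (anti D) (anti D')
      (Sum.inl k)
    rwa [show Matrix.fromCols D.Us D.Un = D.U from rfl,
      show Matrix.fromCols D'.Us D'.Un = D'.U from rfl, ← D.gram_eq, ← D'.gram_eq] at this
  · have := weyl_sub_le (ι := pos) D'.U_mul_conj D.U_conj_mul (anti D') (anti D)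
      (Sum.inl k)
    rwa [show Matrix.fromCols D.Us D.Un = D.U from rfl,
      show Matrix.fromCols D'.Us D'.Un = D'.U from rfl, ← D.gram_eq, ← D'.gram_eq,
      norm_sub_rev] at this

open scoped ComplexOrder in
theorem rank_eq_card (D : SVD A p) :
    A.rank = Fintype.card {j : Fin p ⊕ Fin (Fintype.card m - p) // D.σ (pos j) ≠ 0} := by
  have h1 : A.rank = (Matrix.diagonal fun j : Fin p ⊕ Fin (Fintype.card m - p) =>
      ((D.σ (pos j) ^ 2 : ℝ) : ℂ)).rank := by
    rw [← Matrix.rank_self_mul_conjTranspose]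
    apply le_antisymm
    · rw [D.gram_eq]
      exact (Matrix.rank_mul_le_left _ _).trans (Matrix.rank_mul_le_right _ _)
    · have : Matrix.diagonal (fun j : Fin p ⊕ Fin (Fintype.card m - p) =>
          ((D.σ (pos j) ^ 2 : ℝ) : ℂ)) = D.Uᴴ * (A * Aᴴ) * D.U := by
        have hU : D.Uᴴ * D.U = 1 := D.U_conj_mul
        rw [D.gram_eq, Matrix.mul_assoc D.U, ← Matrix.mul_assoc D.Uᴴ, hU, Matrix.one_mul,
          Matrix.mul_assoc, hU, Matrix.mul_one]
      rw [this]
      exact (Matrix.rank_mul_le_left _ _).trans (Matrix.rank_mul_le_right _ _)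
  rw [h1, Matrix.rank_diagonal]
  exact Fintype.card_congr (Equiv.subtypeEquivRight fun j => by simp)

/-- When the splitting is at the rank, all remaining singular values vanish. -/
theorem σ_noise_eq_zero (D : SVD A p) (hp : A.rank = p) (i : Fin (Fintype.card m - p)) :
    D.σ (p + i) = 0 := by
  by_contra h
  have hpos : ∀ k, k ≤ p + i → D.σ k ≠ 0 := fun k hk h0 =>
    h (le_antisymm (h0 ▸ D.σ_antitone hk) (D.σ_nonneg _))
  let f : Option (Fin p) → {j : Fin p ⊕ Fin (Fintype.card m - p) // D.σ (pos j) ≠ 0} := fun o =>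
    o.elim ⟨Sum.inr i, h⟩ fun k => ⟨Sum.inl k, hpos _ (by simp [pos]; omega)⟩
  have hf : Function.Injective f := by
    rintro (_ | a) (_ | b) hab 
    · rfl
    · exact absurd (congrArg Subtype.val hab) Sum.inr_ne_inl
    · exact absurd (congrArg Subtype.val hab) Sum.inl_ne_inr
    · exact congrArg some (Sum.inl_injective (congrArg Subtype.val hab))
  have := Fintype.card_le_of_injective f hf
  rw [← D.rank_eq_card, hp, Fintype.card_option, Fintype.card_fin] at this
  omega

theorem σ_signal_pos (D : SVD A p) (hp : A.rank = p) (k : Fin p) : 0 < D.σ k := by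
  refine (D.σ_nonneg _).lt_of_ne fun h => ?_
  have hin : ∀ j : {j : Fin p ⊕ Fin (Fintype.card m - p) // D.σ (pos j) ≠ 0},
      ∃ i : Fin p, i ≠ k ∧ Sum.inl i = j.1 := by
    rintro ⟨i | i, hi⟩
    · exact ⟨i, by rintro rfl; exact hi h.symm, rfl⟩
    · exact absurd (D.σ_noise_eq_zero hp i) hi
  choose f hf hf' using hin
  have hinj : Function.Injective fun j => (⟨f j, hf j⟩ : {i : Fin p // i ≠ k}) := by
    intro a b hab
    have : f a = f b := congrArg Subtype.val hab
    exact Subtype.ext (by rw [← hf' a, ← hf' b, this])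
  have := Fintype.card_le_of_injective _ hinj
  rw [← D.rank_eq_card, hp] at this
  simp at this
  have := k.pos
  omega

theorem eq_signal (D : SVD A p) (hp : A.rank = p) : A = D.Us * D.Sig * D.Vsᴴ := by
  have : D.Sn = 0 := by
    ext i j
    simp [Sn, D.σ_noise_eq_zero hp i]
  conv_lhs => rw [D.eq_add, this]
  simp

theorem Sig_mul_inv (D : SVD A p) (h : ∀ k : Fin p, 0 < D.σ k) : D.Sig * D.Sig⁻¹ = 1 := by
  refine Matrix.mul_nonsing_inv _ ?_
  rw [Sig, Matrix.det_diagonal, isUnit_iff_ne_zero]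
  exact Finset.prod_ne_zero_iff.2 fun k _ => by exact_mod_cast (h k).ne'

theorem inv_mul_Sig (D : SVD A p) (h : ∀ k : Fin p, 0 < D.σ k) : D.Sig⁻¹ * D.Sig = 1 :=
  mul_eq_one_comm.1 (D.Sig_mul_inv h)

theorem Sig_inv (D : SVD A p) (h : ∀ k : Fin p, 0 < D.σ k) :
    D.Sig⁻¹ = Matrix.diagonal fun k : Fin p => (D.σ k : ℂ)⁻¹ := by
  refine Matrix.inv_eq_right_inv ?_
  rw [Sig, Matrix.diagonal_mul_diagonal, ← Matrix.diagonal_one]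
  congr 1
  ext k
  exact mul_inv_cancel₀ (by exact_mod_cast (h k).ne')

theorem T_mul (D : SVD A p) (hp : A.rank = p) : D.T * A = A := by
  refine (congrArg (fun B => D.T * B) (D.eq_signal hp)).trans ?_
  rw [← Matrix.mul_assoc, ← Matrix.mul_assoc, T_mul_Us]
  exact (D.eq_signal hp).symm

end SVD

/-! ### Asymptotics of matrix-valued functions -/

section MatrixBigO

open Asymptotics

variable {Ω : Type*} {f : Filter Ω} {a b c : Type*} [Fintype a] [Fintype b] [Fintype c]

theorem matrix_isBigO_mul {X : Ω → Matrix a b ℂ} {Y : Ω → Matrix b c ℂ} {g h : Ω → ℝ}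
    (hX : X =O[f] g) (hY : Y =O[f] h) : (fun ω => X ω * Y ω) =O[f] fun ω => g ω * h ω := by
  refine IsBigO.trans (IsBigO.of_bound 1 (Filter.Eventually.of_forall fun ω => ?_))
    (hX.norm_left.mul hY.norm_left)
  rw [Real.norm_of_nonneg (by positivity), one_mul]
  exact Matrix.frobenius_norm_mul _ _

theorem matrix_isBigO_mul_bdd {X : Ω → Matrix a b ℂ} {Y : Ω → Matrix b c ℂ} {g : Ω → ℝ}
    (hX : X =O[f] g) (hY : Y =O[f] fun _ => (1 : ℝ)) : (fun ω => X ω * Y ω) =O[f] g := by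
  simpa using matrix_isBigO_mul hX hY

theorem matrix_isBigO_bdd_mul {X : Ω → Matrix a b ℂ} {Y : Ω → Matrix b c ℂ} {g : Ω → ℝ}
    (hX : X =O[f] fun _ => (1 : ℝ)) (hY : Y =O[f] g) : (fun ω => X ω * Y ω) =O[f] g := by
  simpa using matrix_isBigO_mul hX hY

theorem matrix_isBigO_mul_sq {X : Ω → Matrix a b ℂ} {Y : Ω → Matrix b c ℂ} {g : Ω → ℝ}
    (hX : X =O[f] g) (hY : Y =O[f] g) : (fun ω => X ω * Y ω) =O[f] fun ω => g ω ^ 2 := by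
  simpa [sq] using matrix_isBigO_mul hX hY

theorem matrix_isBigO_conjTranspose {X : Ω → Matrix a b ℂ} {g : Ω → ℝ} (hX : X =O[f] g) :
    (fun ω => (X ω)ᴴ) =O[f] g :=
  (isBigO_of_le f fun ω => (Matrix.frobenius_norm_conjTranspose (X ω)).le).trans hX

theorem matrix_isBigO_const (X : Matrix a b ℂ) : (fun _ : Ω => X) =O[f] fun _ => (1 : ℝ) :=
  isBigO_const_one ℝ X f

theorem matrix_isBigO_apply {X : Ω → Matrix a b ℂ} {g : Ω → ℝ} (hX : X =O[f] g) (i : a) (j : b) :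
    (fun ω => X ω i j) =O[f] g :=
  (IsBigO.of_bound 1 (Filter.Eventually.of_forall fun ω => by
    rw [one_mul]; exact frobenius_norm_apply_le _ _ _)).trans hX

theorem matrix_isBigO_of_apply {X : Ω → Matrix a b ℂ} {g : Ω → ℝ}
    (hX : ∀ i j, (fun ω => X ω i j) =O[f] g) : X =O[f] g := by
  refine isBigO_norm_left.1 (IsBigO.of_pow two_ne_zero ?_)
  have : (fun ω => ‖X ω‖) ^ 2 = fun ω => ∑ i, ∑ j, ‖X ω i j‖ ^ 2 := by
    ext ω
    exact frobenius_norm_sq _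
  rw [this]
  exact IsBigO.fun_sum fun i _ => IsBigO.fun_sum fun j _ => ((hX i j).norm_left.pow 2)

end MatrixBigO

/-! ### Perturbation of singular subspaces and singular vectors -/

namespace SVD

open Asymptotics

variable {Ω : Type*} {f : Filter Ω} {ε : Ω → ℝ} {m n : Type} [Fintype m] [Fintype n]
  [DecidableEq m] [DecidableEq n] {A₀ : Matrix m n ℂ} {A : Ω → Matrix m n ℂ} {p : ℕ}

/-- The matrices `A ω` are perturbations of size `O(ε)` of a matrix `A₀` of rank `p`; for all of
them the `p` dominant singular values are bounded away from zero. -/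
structure IsPerturbation (S : SVD A₀ p) (D : ∀ ω, SVD (A ω) p) (f : Filter Ω) (ε : Ω → ℝ) :
    Prop where
  rank_eq : A₀.rank = p
  error : (fun ω => A ω - A₀) =O[f] ε
  small : ε =O[f] fun _ => (1 : ℝ)
  gap : ∃ c : ℝ, 0 < c ∧ ∀ ω (k : Fin p), c ≤ (D ω).σ k

theorem norm_Us (D : SVD A₀ p) : ‖D.Us‖ = ‖(1 : Matrix (Fin p) (Fin p) ℂ)‖ := by
  rw [← frobenius_norm_isometry_mul D.Us_conj_mul_Us 1, Matrix.mul_one]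

theorem norm_Vs (D : SVD A₀ p) : ‖D.Vs‖ = ‖(1 : Matrix (Fin p) (Fin p) ℂ)‖ := by
  rw [← frobenius_norm_isometry_mul D.Vs_conj_mul_Vs 1, Matrix.mul_one]

theorem Un_mul_Γn (S : SVD A₀ p) (E : Matrix m n ℂ) :
    S.Un * S.Γn E = (1 - S.T) * E * S.Vs * S.Sig⁻¹ := by
  rw [Γn, ← S.Un_mul_conj]
  simp only [Matrix.mul_assoc]

namespace IsPerturbation

variable {S : SVD A₀ p} {D : ∀ ω, SVD (A ω) p}

theorem pos (h : IsPerturbation S D f ε) (ω : Ω) (k : Fin p) : 0 < (D ω).σ k := by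
  obtain ⟨c, hc, hc'⟩ := h.gap
  exact hc.trans_le (hc' ω k)

theorem Us_bdd (_ : IsPerturbation S D f ε) : (fun ω => (D ω).Us) =O[f] fun _ => (1 : ℝ) :=
  (isBigO_of_le f fun ω => (D ω).norm_Us.le).trans
    (isBigO_const_one ℝ (1 : Matrix (Fin p) (Fin p) ℂ) f)

theorem Vs_bdd (_ : IsPerturbation S D f ε) : (fun ω => (D ω).Vs) =O[f] fun _ => (1 : ℝ) :=
  (isBigO_of_le f fun ω => (D ω).norm_Vs.le).trans
    (isBigO_const_one ℝ (1 : Matrix (Fin p) (Fin p) ℂ) f)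

theorem Sig_inv_bdd (h : IsPerturbation S D f ε) :
    (fun ω => (D ω).Sig⁻¹) =O[f] fun _ => (1 : ℝ) := by
  obtain ⟨c, hc, hc'⟩ := h.gap
  refine matrix_isBigO_of_apply fun k l => ?_
  by_cases hkl : k = l
  · subst hkl
    refine IsBigO.of_bound c⁻¹ (Filter.Eventually.of_forall fun ω => ?_)
    rw [(D ω).Sig_inv (h.pos ω), Matrix.diagonal_apply_eq, norm_inv, Complex.norm_real,
      Real.norm_of_nonneg ((D ω).σ_nonneg _), norm_one, mul_one]
    exact inv_anti₀ hc (hc' ω k)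
  · refine IsBigO.congr_left (isBigO_zero _ _) fun ω => ?_
    rw [(D ω).Sig_inv (h.pos ω), Matrix.diagonal_apply_ne _ hkl]

theorem bdd (h : IsPerturbation S D f ε) : A =O[f] fun _ => (1 : ℝ) :=
  ((h.error.trans h.small).add (matrix_isBigO_const A₀)).congr_left fun ω => by simp

theorem gram_error (h : IsPerturbation S D f ε) :
    (fun ω => A ω * (A ω)ᴴ - A₀ * A₀ᴴ) =O[f] ε := by
  refine ((matrix_isBigO_mul_bdd h.error (matrix_isBigO_conjTranspose h.bdd)).add
    (matrix_isBigO_bdd_mul (matrix_isBigO_const A₀)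
      (matrix_isBigO_conjTranspose h.error))).congr_left fun ω => ?_
  simp [Matrix.sub_mul, Matrix.mul_sub]

theorem σ_sq_error (h : IsPerturbation S D f ε) (k : Fin p) :
    (fun ω => (D ω).σ k ^ 2 - S.σ k ^ 2) =O[f] ε := by
  refine (IsBigO.of_bound 1 (Filter.Eventually.of_forall fun ω => ?_)).trans h.gram_error
  rw [one_mul]
  exact S.abs_sq_sub_sq_le (D ω) k

theorem compl_mul_Us_eq (h : IsPerturbation S D f ε) (ω : Ω) :
    (1 - S.T) * (D ω).Us = (1 - S.T) * (A ω - A₀) * (D ω).Vs * (D ω).Sig⁻¹ := by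
  have h1 : (1 - S.T) * A₀ = 0 := by rw [Matrix.sub_mul, S.T_mul h.rank_eq]; simp
  rw [Matrix.mul_sub, h1, sub_zero, Matrix.mul_assoc _ (A ω), (D ω).mul_Vs, Matrix.mul_assoc,
    Matrix.mul_assoc, (D ω).Sig_mul_inv (h.pos ω), Matrix.mul_one]

theorem compl_mul_Us (h : IsPerturbation S D f ε) :
    (fun ω => (1 - S.T) * (D ω).Us) =O[f] ε :=
  (matrix_isBigO_mul_bdd (matrix_isBigO_mul_bdd (matrix_isBigO_bdd_mul
    (matrix_isBigO_const _) h.error) h.Vs_bdd) h.Sig_inv_bdd).congr_left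
      fun ω => (h.compl_mul_Us_eq ω).symm

theorem compl_mul_Us₀ (h : IsPerturbation S D f ε) :
    (fun ω => (1 - (D ω).T) * S.Us) =O[f] ε :=
  (isBigO_of_le f fun ω =>
    (frobenius_norm_compl_mul_comm (D ω).Us_conj_mul_Us S.Us_conj_mul_Us).le).trans h.compl_mul_Us

/-- The truncated pseudoinverse of `(A ω)(A ω)ᴴ` is, on the signal subspace, a first-order
approximation of that of `A₀ A₀ᴴ`. -/
theorem gram_pinv_error (h : IsPerturbation S D f ε) :
    (fun ω => (D ω).Us * ((D ω).Sig⁻¹ * (D ω).Sig⁻¹) * (D ω).Usᴴ * S.T -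
      S.Us * (S.Sig⁻¹ * S.Sig⁻¹) * S.Usᴴ) =O[f] ε := by
  have hG : (fun ω => (D ω).Us * ((D ω).Sig⁻¹ * (D ω).Sig⁻¹) * (D ω).Usᴴ) =O[f]
      fun _ => (1 : ℝ) :=
    matrix_isBigO_mul_bdd (matrix_isBigO_mul_bdd h.Us_bdd
      (matrix_isBigO_mul_bdd h.Sig_inv_bdd h.Sig_inv_bdd)) (matrix_isBigO_conjTranspose h.Us_bdd)
  have h1 := matrix_isBigO_mul_bdd h.compl_mul_Us₀
    (matrix_isBigO_const (f := f) (S.Sig⁻¹ * S.Sig⁻¹ * S.Usᴴ))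
  have h2 := matrix_isBigO_mul_bdd (matrix_isBigO_bdd_mul hG h.gram_error)
    (matrix_isBigO_const (f := f) (S.Us * (S.Sig⁻¹ * S.Sig⁻¹) * S.Usᴴ))
  refine (h1.neg_left.sub h2).congr_left fun ω => ?_
  have e0 : A₀ * A₀ᴴ * (S.Us * (S.Sig⁻¹ * S.Sig⁻¹) * S.Usᴴ) = S.T := by
    have hs := S.Sig_mul_inv (S.σ_signal_pos h.rank_eq)
    calc _ = A₀ * A₀ᴴ * S.Us * (S.Sig⁻¹ * S.Sig⁻¹) * S.Usᴴ := by simp only [Matrix.mul_assoc]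
      _ = S.Us * (S.Sig * (S.Sig * S.Sig⁻¹) * S.Sig⁻¹) * S.Usᴴ := by
        rw [S.gram_mul_Us]; simp only [Matrix.mul_assoc]
      _ = S.T := by rw [hs, Matrix.mul_one, hs, Matrix.mul_one, T]
  have e1 : (D ω).Us * ((D ω).Sig⁻¹ * (D ω).Sig⁻¹) * (D ω).Usᴴ * (A ω * (A ω)ᴴ) = (D ω).T := by
    have hs := (D ω).inv_mul_Sig (h.pos ω)
    calc _ = (D ω).Us * ((D ω).Sig⁻¹ * (D ω).Sig⁻¹) * ((D ω).Usᴴ * (A ω * (A ω)ᴴ)) := by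
          simp only [Matrix.mul_assoc]
      _ = (D ω).Us * ((D ω).Sig⁻¹ * ((D ω).Sig⁻¹ * (D ω).Sig) * (D ω).Sig) * (D ω).Usᴴ := by
        rw [(D ω).Us_conj_mul_gram]; simp only [Matrix.mul_assoc]
      _ = (D ω).T := by rw [hs, Matrix.mul_one, hs, Matrix.mul_one, T]
  rw [Matrix.mul_sub, e1, Matrix.sub_mul _ _ (S.Us * _ * _), Matrix.mul_assoc _ (A₀ * A₀ᴴ), e0]
  simp only [Matrix.sub_mul, Matrix.one_mul, Matrix.mul_assoc]
  abel

/-- The off-diagonal block of the perturbed signal projection, to first order. -/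
theorem compl_mul_T_mul_T (h : IsPerturbation S D f ε) :
    (fun ω => (1 - S.T) * (D ω).T * S.T - S.Un * S.Γn (A ω - A₀) * S.Usᴴ) =O[f]
      fun ω => ε ω ^ 2 := by
  have h1 := matrix_isBigO_bdd_mul (matrix_isBigO_conjTranspose h.bdd) h.gram_pinv_error
  have h2 := matrix_isBigO_mul_bdd (matrix_isBigO_conjTranspose h.error)
    (matrix_isBigO_const (f := f) (S.Us * (S.Sig⁻¹ * S.Sig⁻¹) * S.Usᴴ))
  refine (matrix_isBigO_mul_sq (matrix_isBigO_bdd_mul (matrix_isBigO_const (1 - S.T)) h.error)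
    (h1.add h2)).congr_left fun ω => ?_
  have e0 : A₀ᴴ * (S.Us * (S.Sig⁻¹ * S.Sig⁻¹) * S.Usᴴ) = S.Vs * S.Sig⁻¹ * S.Usᴴ := by
    calc _ = A₀ᴴ * S.Us * (S.Sig⁻¹ * S.Sig⁻¹) * S.Usᴴ := by simp only [Matrix.mul_assoc]
      _ = S.Vs * (S.Sig * S.Sig⁻¹ * S.Sig⁻¹) * S.Usᴴ := by
        rw [S.conjTranspose_mul_Us]; simp only [Matrix.mul_assoc]
      _ = _ := by rw [S.Sig_mul_inv (S.σ_signal_pos h.rank_eq), Matrix.one_mul]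
  have e1 : (A ω)ᴴ * ((D ω).Us * ((D ω).Sig⁻¹ * (D ω).Sig⁻¹) * (D ω).Usᴴ * S.T) =
      (D ω).Vs * (D ω).Sig⁻¹ * ((D ω).Usᴴ * S.T) := by
    calc _ = (A ω)ᴴ * (D ω).Us * ((D ω).Sig⁻¹ * (D ω).Sig⁻¹) * ((D ω).Usᴴ * S.T) := by
          simp only [Matrix.mul_assoc]
      _ = (D ω).Vs * ((D ω).Sig * (D ω).Sig⁻¹ * (D ω).Sig⁻¹) * ((D ω).Usᴴ * S.T) := by
        rw [(D ω).conjTranspose_mul_Us]; simp only [Matrix.mul_assoc]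
      _ = _ := by rw [(D ω).Sig_mul_inv (h.pos ω), Matrix.one_mul]
  rw [Matrix.mul_sub (A ω)ᴴ, e1, Matrix.conjTranspose_sub, Matrix.sub_mul _ _ (S.Us * _ * _), e0,
    sub_add_sub_cancel,
    Un_mul_Γn, Matrix.mul_sub ((1 - S.T) * _)]
  congr 1
  · rw [show (D ω).T = (D ω).Us * (D ω).Usᴴ from rfl, ← Matrix.mul_assoc (1 - S.T),
      h.compl_mul_Us_eq]
    simp only [Matrix.mul_assoc]
  · simp only [Matrix.mul_assoc]

/-- First-order expansion of the projection onto the signal subspace. -/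
theorem T_expansion (h : IsPerturbation S D f ε) :
    (fun ω => (D ω).T - S.T - (S.Un * S.Γn (A ω - A₀) * S.Usᴴ +
      (S.Un * S.Γn (A ω - A₀) * S.Usᴴ)ᴴ)) =O[f] fun ω => ε ω ^ 2 := by
  have h1 := h.compl_mul_T_mul_T
  have h2 := matrix_isBigO_mul_sq h.compl_mul_Us (matrix_isBigO_conjTranspose h.compl_mul_Us)
  have h3' := matrix_isBigO_mul_bdd h.compl_mul_Us₀ (matrix_isBigO_const (f := f) S.Usᴴ)
  have h3 := matrix_isBigO_mul_sq (matrix_isBigO_conjTranspose h3') h3'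
  refine ((h1.add (matrix_isBigO_conjTranspose h1)).add (h2.sub h3)).congr_left fun ω => ?_
  have e1 : (1 - S.T) * (D ω).Us * ((1 - S.T) * (D ω).Us)ᴴ = (1 - S.T) * (D ω).T * (1 - S.T) := by
    rw [Matrix.conjTranspose_mul, Matrix.conjTranspose_sub, Matrix.conjTranspose_one,
      S.T_conjTranspose, show (D ω).T = (D ω).Us * (D ω).Usᴴ from rfl]
    simp only [Matrix.mul_assoc]
  have e2 : ((1 - (D ω).T) * S.Us * S.Usᴴ)ᴴ * ((1 - (D ω).T) * S.Us * S.Usᴴ) =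
      S.T * (1 - (D ω).T) * S.T := by
    rw [Matrix.mul_assoc _ S.Us, show S.Us * S.Usᴴ = S.T from rfl, Matrix.conjTranspose_mul,
      Matrix.conjTranspose_sub,
      Matrix.conjTranspose_one, S.T_conjTranspose, (D ω).T_conjTranspose, Matrix.mul_assoc S.T,
      ← Matrix.mul_assoc _ _ S.T, Matrix.mul_sub _ 1, Matrix.sub_mul _ _ (D ω).T, T_mul_T]
    simp [Matrix.mul_assoc]
  have e3 : S.T * (1 - (D ω).T) * S.T = S.T - S.T * (D ω).T * S.T := by
    rw [Matrix.mul_sub, Matrix.sub_mul, Matrix.mul_one, T_mul_T]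
  rw [e1, e2, e3]
  simp only [Matrix.conjTranspose_sub, Matrix.conjTranspose_mul, S.T_conjTranspose,
    (D ω).T_conjTranspose, Matrix.conjTranspose_one]
  noncomm_ring

/-- The Sylvester equation of the overlap matrix of the two families of singular vectors. -/
theorem overlap_apply (ω : Ω) (k l : Fin p) :
    (S.Usᴴ * (D ω).Us) k l * (((D ω).σ l ^ 2 - S.σ k ^ 2 : ℝ) : ℂ) =
      (S.Usᴴ * (A ω * (A ω)ᴴ - A₀ * A₀ᴴ) * (D ω).Us) k l := by
  have : S.Usᴴ * (A ω * (A ω)ᴴ - A₀ * A₀ᴴ) * (D ω).Us =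
      S.Usᴴ * (D ω).Us * ((D ω).Sig * (D ω).Sig) - S.Sig * S.Sig * (S.Usᴴ * (D ω).Us) := by
    rw [Matrix.mul_sub, Matrix.sub_mul, S.Us_conj_mul_gram, Matrix.mul_assoc, (D ω).gram_mul_Us]
    simp only [Matrix.mul_assoc]
  rw [this, Sig, Sig, Matrix.diagonal_mul_diagonal, Matrix.diagonal_mul_diagonal, Matrix.sub_apply,
    Matrix.mul_diagonal, Matrix.diagonal_mul]
  push_cast
  ring

theorem overlap_bdd (h : IsPerturbation S D f ε) :
    (fun ω => S.Usᴴ * (D ω).Us) =O[f] fun _ => (1 : ℝ) :=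
  matrix_isBigO_bdd_mul (matrix_isBigO_const _) h.Us_bdd

theorem sq_sub_sq_ne_zero (S : SVD A₀ p) (hσ : Function.Injective fun k : Fin p => S.σ k)
    {k l : Fin p} (hkl : k ≠ l) : (S.σ l : ℂ) ^ 2 - (S.σ k : ℂ) ^ 2 ≠ 0 := by
  have : S.σ l ^ 2 - S.σ k ^ 2 ≠ 0 := sub_ne_zero.2 fun h =>
    hkl (hσ ((sq_eq_sq₀ (S.σ_nonneg _) (S.σ_nonneg _)).1 h)).symm
  exact_mod_cast this

theorem overlap_offDiag (h : IsPerturbation S D f ε)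
    (hσ : Function.Injective fun k : Fin p => S.σ k) {k l : Fin p} (hkl : k ≠ l) :
    (fun ω => (S.Usᴴ * (D ω).Us) k l) =O[f] ε := by
  have h1 := matrix_isBigO_apply (matrix_isBigO_mul_bdd
    (matrix_isBigO_bdd_mul (matrix_isBigO_const S.Usᴴ) h.gram_error) h.Us_bdd) k l
  have h2 : (fun ω => (S.Usᴴ * (D ω).Us) k l * (((D ω).σ l ^ 2 - S.σ l ^ 2 : ℝ) : ℂ)) =O[f] ε := by
    have := (matrix_isBigO_apply h.overlap_bdd k l).mul
      (Complex.isBigO_ofReal_left.2 (h.σ_sq_error l))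
    simpa using this
  refine ((h1.sub h2).const_mul_left ((S.σ l : ℂ) ^ 2 - (S.σ k : ℂ) ^ 2)⁻¹).congr_left fun ω => ?_
  rw [← overlap_apply, ← mul_sub, inv_mul_eq_iff_eq_mul₀ (sq_sub_sq_ne_zero S hσ hkl)]
  push_cast
  ring

/-- A perturbed singular vector has unit length, and its components along the other singular vectors
and the noise subspace are `O(ε)`, so the modulus of its overlap with the unperturbed one is `1` up
to second order. Phase alignment makes this overlap real and nonnegative. -/
theorem overlap_diag (h : IsPerturbation S D f ε)
    (hσ : Function.Injective fun k : Fin p => S.σ k)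
    (hph : ∀ ω (k : Fin p),
      ((S.Usᴴ * (D ω).Us) k k).im = 0 ∧ 0 ≤ ((S.Usᴴ * (D ω).Us) k k).re) (k : Fin p) :
    (fun ω => (S.Usᴴ * (D ω).Us) k k - 1) =O[f] fun ω => ε ω ^ 2 := by
  have h1 := matrix_isBigO_apply (matrix_isBigO_mul_sq
    (matrix_isBigO_conjTranspose h.compl_mul_Us) h.compl_mul_Us) k k
  have h2 : (fun ω => ∑ j ∈ Finset.univ.erase k, ‖(S.Usᴴ * (D ω).Us) j k‖ ^ 2) =O[f]
      fun ω => ε ω ^ 2 :=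
    IsBigO.fun_sum fun j hj => (h.overlap_offDiag hσ (Finset.ne_of_mem_erase hj)).norm_left.pow 2
  refine IsBigO.trans (isBigO_of_le f fun ω => ?_)
    (h1.add (Complex.isBigO_ofReal_left.2 h2))
  obtain ⟨him, hre⟩ := hph ω k
  set P := S.Usᴴ * (D ω).Us with hP
  have e1 : ((1 - S.T) * (D ω).Us)ᴴ * ((1 - S.T) * (D ω).Us) = 1 - Pᴴ * P := by
    rw [Matrix.conjTranspose_mul, Matrix.conjTranspose_sub, Matrix.conjTranspose_one,
      S.T_conjTranspose, Matrix.mul_assoc, ← Matrix.mul_assoc (1 - S.T), Matrix.mul_sub (1 - S.T),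
      Matrix.mul_one, Matrix.sub_mul _ _ S.T, T_mul_T, Matrix.one_mul, sub_self, sub_zero,
      Matrix.sub_mul, Matrix.mul_sub, Matrix.one_mul, (D ω).Us_conj_mul_Us, hP, T]
    simp only [Matrix.conjTranspose_mul, Matrix.conjTranspose_conjTranspose, Matrix.mul_assoc]
  have e2 : (Pᴴ * P) k k = ((P k k).re ^ 2 : ℝ) +
      ((∑ j ∈ Finset.univ.erase k, ‖P j k‖ ^ 2 : ℝ) : ℂ) := by
    rw [Matrix.mul_apply, ← Finset.add_sum_erase _ _ (Finset.mem_univ k)]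
    push_cast
    congr 1
    · have : P k k = ((P k k).re : ℂ) := Complex.ext rfl (by simp [him])
      rw [Matrix.conjTranspose_apply, this]
      simp [sq]
    · refine Finset.sum_congr rfl fun j _ => ?_
      rw [Matrix.conjTranspose_apply, Complex.star_def, mul_comm, Complex.mul_conj,
        Complex.normSq_eq_norm_sq]
      push_cast
      rfl
  have e3 : P k k = ((P k k).re : ℂ) := Complex.ext rfl (by simp [him])
  rw [e1, Matrix.sub_apply, e2, Matrix.one_apply_eq, e3]
  have e4 : (1 : ℂ) - (((P k k).re ^ 2 : ℝ) + ((∑ j ∈ Finset.univ.erase k, ‖P j k‖ ^ 2 : ℝ) : ℂ)) +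
      ((∑ j ∈ Finset.univ.erase k, ‖P j k‖ ^ 2 : ℝ) : ℂ) = ((1 - (P k k).re ^ 2 : ℝ) : ℂ) := by
    push_cast
    ring
  rw [Complex.ofReal_re, e4, ← Complex.ofReal_one, ← Complex.ofReal_sub, Complex.norm_real,
    Complex.norm_real, Real.norm_eq_abs, Real.norm_eq_abs,
    show 1 - (P k k).re ^ 2 = -(((P k k).re - 1) * ((P k k).re + 1)) by ring, abs_neg, abs_mul,
    abs_of_nonneg (add_nonneg hre zero_le_one)]
  exact le_mul_of_one_le_right (abs_nonneg _) (by linarith)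

theorem Un_mul_Γn_isBigO (h : IsPerturbation S D f ε) :
    (fun ω => S.Un * S.Γn (A ω - A₀)) =O[f] ε := by
  refine (matrix_isBigO_mul_bdd (matrix_isBigO_bdd_mul (matrix_isBigO_const (1 - S.T)) h.error)
    (matrix_isBigO_const (S.Vs * S.Sig⁻¹))).congr_left fun ω => ?_
  rw [Un_mul_Γn]
  simp only [Matrix.mul_assoc]

theorem sq_small (h : IsPerturbation S D f ε) : (fun ω => ε ω ^ 2) =O[f] ε := by
  simpa [sq] using (isBigO_refl ε f).mul h.small

theorem overlap_sub_one (h : IsPerturbation S D f ε)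
    (hσ : Function.Injective fun k : Fin p => S.σ k)
    (hph : ∀ ω (k : Fin p),
      ((S.Usᴴ * (D ω).Us) k k).im = 0 ∧ 0 ≤ ((S.Usᴴ * (D ω).Us) k k).re) :
    (fun ω => S.Usᴴ * (D ω).Us - 1) =O[f] ε := by
  refine matrix_isBigO_of_apply fun k l => ?_
  by_cases hkl : k = l
  · subst hkl
    simpa using (h.overlap_diag hσ hph k).trans h.sq_small
  · simpa [Matrix.one_apply_ne hkl] using h.overlap_offDiag hσ hkl

theorem Us_sub_eq (ω : Ω) : (D ω).Us - S.Us =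
    (1 - S.T) * (D ω).Us + S.Us * (S.Usᴴ * (D ω).Us - 1) := by
  rw [Matrix.mul_sub, Matrix.sub_mul, T, Matrix.one_mul, Matrix.mul_one, Matrix.mul_assoc]
  abel

theorem Us_error (h : IsPerturbation S D f ε)
    (hσ : Function.Injective fun k : Fin p => S.σ k)
    (hph : ∀ ω (k : Fin p),
      ((S.Usᴴ * (D ω).Us) k k).im = 0 ∧ 0 ≤ ((S.Usᴴ * (D ω).Us) k k).re) :
    (fun ω => (D ω).Us - S.Us) =O[f] ε :=
  (h.compl_mul_Us.add (matrix_isBigO_bdd_mul (matrix_isBigO_const S.Us)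
    (h.overlap_sub_one hσ hph))).congr_left fun ω => (Us_sub_eq ω).symm

theorem overlap_expansion (h : IsPerturbation S D f ε)
    (hσ : Function.Injective fun k : Fin p => S.σ k)
    (hph : ∀ ω (k : Fin p),
      ((S.Usᴴ * (D ω).Us) k k).im = 0 ∧ 0 ≤ ((S.Usᴴ * (D ω).Us) k k).re) :
    (fun ω => S.Usᴴ * (D ω).Us - 1 - S.Γs (A ω - A₀)) =O[f] fun ω => ε ω ^ 2 := by
  refine matrix_isBigO_of_apply fun k l => ?_
  by_cases hkl : k = l
  · subst hkl
    simpa [Γs] using h.overlap_diag hσ hph k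
  have h1 : (fun ω => (S.Usᴴ * (D ω).Us) k l * (((D ω).σ l ^ 2 - S.σ l ^ 2 : ℝ) : ℂ)) =O[f]
      fun ω => ε ω ^ 2 := by
    have := (h.overlap_offDiag hσ hkl).mul (Complex.isBigO_ofReal_left.2 (h.σ_sq_error l))
    simpa [sq] using this
  have h2 := matrix_isBigO_apply (matrix_isBigO_mul_sq
    (matrix_isBigO_bdd_mul (matrix_isBigO_const S.Usᴴ) h.gram_error) (h.Us_error hσ hph)) k l
  have h3 := matrix_isBigO_apply (matrix_isBigO_mul_bdd (matrix_isBigO_bdd_mul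
    (matrix_isBigO_const S.Usᴴ) (matrix_isBigO_mul_sq h.error
      (matrix_isBigO_conjTranspose h.error))) (matrix_isBigO_const S.Us)) k l
  refine (((h2.add h3).sub h1).const_mul_left
    ((S.σ l : ℂ) ^ 2 - (S.σ k : ℂ) ^ 2)⁻¹).congr_left fun ω => ?_
  have e1 : S.Usᴴ * (A ω * (A ω)ᴴ - A₀ * A₀ᴴ) * ((D ω).Us - S.Us) +
      S.Usᴴ * ((A ω - A₀) * (A ω - A₀)ᴴ) * S.Us =
      S.Usᴴ * (A ω * (A ω)ᴴ - A₀ * A₀ᴴ) * (D ω).Us -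
        (S.Usᴴ * (A ω - A₀) * S.Vs * S.Sig + S.Sig * S.Vsᴴ * (A ω - A₀)ᴴ * S.Us) := by
    rw [← S.Us_conj_mul, Matrix.mul_assoc _ S.Vs, ← S.conjTranspose_mul_Us]
    simp only [Matrix.mul_sub, Matrix.sub_mul, Matrix.conjTranspose_sub, Matrix.mul_assoc]
    abel
  rw [← Matrix.add_apply, e1, Matrix.sub_apply, ← overlap_apply,
    inv_mul_eq_iff_eq_mul₀ (sq_sub_sq_ne_zero S hσ hkl), Γs]
  simp only [Matrix.sub_apply, Matrix.one_apply_ne hkl, Matrix.hadamard_apply, Matrix.of_apply,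
    if_neg hkl, mul_sub, ← mul_assoc, mul_one_div_cancel (sq_sub_sq_ne_zero S hσ hkl)]
  push_cast
  ring

/-- First-order expansion of the dominant singular vectors. -/
theorem Us_expansion (h : IsPerturbation S D f ε)
    (hσ : Function.Injective fun k : Fin p => S.σ k)
    (hph : ∀ ω (k : Fin p),
      ((S.Usᴴ * (D ω).Us) k k).im = 0 ∧ 0 ≤ ((S.Usᴴ * (D ω).Us) k k).re) :
    (fun ω => (D ω).Us - S.Us - (S.Un * S.Γn (A ω - A₀) + S.Us * S.Γs (A ω - A₀))) =O[f]
      fun ω => ε ω ^ 2 := by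
  have h1 := matrix_isBigO_mul_bdd h.compl_mul_T_mul_T h.Us_bdd
  have h2 := matrix_isBigO_mul_bdd (matrix_isBigO_mul_sq h.compl_mul_Us
    (matrix_isBigO_conjTranspose h.compl_mul_Us)) h.Us_bdd
  have h4 := matrix_isBigO_mul_sq h.Un_mul_Γn_isBigO (h.overlap_sub_one hσ hph)
  have h5 := matrix_isBigO_bdd_mul (matrix_isBigO_const S.Us) (h.overlap_expansion hσ hph)
  refine (((h1.add h2).add h4).add h5).congr_left fun ω => ?_
  have e1 : (1 - S.T) * (D ω).Us * ((1 - S.T) * (D ω).Us)ᴴ =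
      (1 - S.T) * (D ω).T - (1 - S.T) * (D ω).T * S.T := by
    rw [Matrix.conjTranspose_mul, Matrix.conjTranspose_sub, Matrix.conjTranspose_one,
      S.T_conjTranspose, show (D ω).T = (D ω).Us * (D ω).Usᴴ from rfl]
    simp only [Matrix.mul_assoc, Matrix.mul_sub, Matrix.mul_one]
  have e2 : (1 - S.T) * (D ω).T * (D ω).Us = (1 - S.T) * (D ω).Us := by
    rw [Matrix.mul_assoc, T_mul_Us]
  rw [e1, Matrix.sub_mul _ _ (D ω).Us, Matrix.sub_mul _ _ (D ω).Us, e2, Us_sub_eq ω,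
    Matrix.mul_sub, Matrix.mul_sub, Matrix.mul_sub,
    Matrix.mul_assoc (_ * S.Γn _)]
  simp only [Matrix.mul_one]
  abel

end IsPerturbation

end SVD

/-! ### Kronecker products and unfoldings -/

section Kronecker

variable {R : ℕ} {I J L : Fin R → Type}

theorem kroneckerAll_mul [∀ r, Fintype (J r)] (A : ∀ r, Matrix (I r) (J r) ℂ)
    (B : ∀ r, Matrix (J r) (L r) ℂ) :
    kroneckerAll A * kroneckerAll B = kroneckerAll fun r => A r * B r := by
  classical
  ext i l
  simp only [kroneckerAll, Matrix.mul_apply, Matrix.of_apply, ← Finset.prod_mul_distrib]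
  rw [Finset.prod_univ_sum, Fintype.piFinset_univ]

theorem kroneckerAll_one [∀ r, DecidableEq (I r)] :
    kroneckerAll (fun r => (1 : Matrix (I r) (I r) ℂ)) = 1 := by
  ext i j
  simp only [kroneckerAll, Matrix.of_apply, Matrix.one_apply, Finset.prod_ite_zero,
    Finset.prod_const_one, Finset.mem_univ, forall_const, funext_iff]

theorem kroneckerAll_eq_zero {A : ∀ r, Matrix (I r) (J r) ℂ} {r : Fin R} (h : A r = 0) :
    kroneckerAll A = 0 := by
  ext i j
  exact Finset.prod_eq_zero (Finset.mem_univ r) (by simp [h])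

theorem kroneckerAll_update_apply (T : ∀ r, Matrix (I r) (J r) ℂ) (r : Fin R)
    (A : Matrix (I r) (J r) ℂ) (i : ∀ r, I r) (j : ∀ r, J r) :
    kroneckerAll (Function.update T r A) i j =
      A (i r) (j r) * ∏ s ∈ Finset.univ.erase r, T s (i s) (j s) := by
  rw [kroneckerAll, Matrix.of_apply, ← Finset.mul_prod_erase _ _ (Finset.mem_univ r),
    Function.update_self]
  congr 1
  exact Finset.prod_congr rfl fun s hs => by rw [Function.update_of_ne (Finset.ne_of_mem_erase hs)]

theorem kroneckerAll_update_add (T : ∀ r, Matrix (I r) (J r) ℂ) (r : Fin R)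
    (A B : Matrix (I r) (J r) ℂ) :
    kroneckerAll (Function.update T r (A + B)) =
      kroneckerAll (Function.update T r A) + kroneckerAll (Function.update T r B) := by
  ext i j
  simp only [Matrix.add_apply, kroneckerAll_update_apply, add_mul]

variable {K : Type}

/-- A matrix that fixes the `r`-mode vectors of `X` fixes `X` when it acts in the mode `r` alone. -/
theorem kroneckerAll_update_one_mul [∀ r, Fintype (I r)] [∀ r, DecidableEq (I r)] [Fintype K]
    (X : Tensor I K) (r : Fin R) {B : Matrix (I r) (I r) ℂ} (h : B * X.unfold r = X.unfold r) :
    kroneckerAll (Function.update (fun s => (1 : Matrix (I s) (I s) ℂ)) r B) * X.lastUnfoldT =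
      X.lastUnfoldT := by
  ext i k
  rw [Matrix.mul_apply, ← (Equiv.piSplitAt r I).symm.sum_comp, Fintype.sum_prod_type]
  have h1 := congrFun (congrFun h (i r)) ((Equiv.piSplitAt r I i).2, k)
  have h2 : X.unfold r (i r) ((Equiv.piSplitAt r I i).2, k) = X.lastUnfoldT i k := by
    change X ((Equiv.piSplitAt r I).symm (Equiv.piSplitAt r I i)) k = X i k
    rw [Equiv.symm_apply_apply]
  rw [← h2, ← h1, Matrix.mul_apply]
  refine Finset.sum_congr rfl fun a _ => ?_
  have h3 : ∀ c : (∀ s : {s // s ≠ r}, I s),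
      kroneckerAll (Function.update (fun s => (1 : Matrix (I s) (I s) ℂ)) r B) i
        ((Equiv.piSplitAt r I).symm (a, c)) =
          if (Equiv.piSplitAt r I i).2 = c then B (i r) a else 0 := by
    intro c
    have h4 : ∀ s : {s // s ≠ r}, Function.update (fun s => (1 : Matrix (I s) (I s) ℂ)) r B s.1
        (i s.1) ((Equiv.piSplitAt r I).symm (a, c) s.1) = if i s.1 = c s then 1 else 0 := by
      intro s
      rw [Function.update_of_ne s.2, Matrix.one_apply]
      simp [Equiv.piSplitAt, s.2]
    have h5 : (Equiv.piSplitAt r I).symm (a, c) r = a := by simp [Equiv.piSplitAt]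
    rw [kroneckerAll, Matrix.of_apply, Fintype.prod_eq_mul_prod_subtype_ne _ r,
      Function.update_self, h5, Finset.prod_congr rfl fun s _ => h4 s, Finset.prod_ite_zero]
    simp [Equiv.piSplitAt, funext_iff]
  rw [Finset.sum_congr rfl fun c _ => by rw [h3 c, ite_mul, zero_mul], Finset.sum_ite_eq]
  simp [Tensor.lastUnfoldT, Tensor.unfold]

theorem kroneckerAll_mul_lastUnfoldT [∀ r, Fintype (I r)] [∀ r, DecidableEq (I r)] [Fintype K]
    (X : Tensor I K) {T : ∀ r, Matrix (I r) (I r) ℂ} (h : ∀ r, T r * X.unfold r = X.unfold r) :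
    kroneckerAll T * X.lastUnfoldT = X.lastUnfoldT := by
  have key : ∀ s : Finset (Fin R),
      kroneckerAll (fun r => if r ∈ s then T r else 1) * X.lastUnfoldT = X.lastUnfoldT := by
    intro s
    induction s using Finset.induction_on with
    | empty => simp [kroneckerAll_one]
    | insert r s hr ih =>
      have : kroneckerAll (fun q => if q ∈ insert r s then T q else 1) =
          kroneckerAll (fun q => if q ∈ s then T q else 1) *
            kroneckerAll (Function.update (fun q => (1 : Matrix (I q) (I q) ℂ)) r (T r)) := by
        rw [kroneckerAll_mul]
        congr 1
        ext1 q
        by_cases hq : q = r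
        · subst hq; simp [hr]
        · simp [hq]
      rw [this, Matrix.mul_assoc, kroneckerAll_update_one_mul X r (h r), ih]
  simpa using key Finset.univ

/-- A Kronecker product whose `r`-th factor annihilates the `r`-mode signal space annihilates the
whole signal. -/
theorem kroneckerAll_mul_lastUnfoldT_eq_zero [∀ r, Fintype (I r)] [∀ r, DecidableEq (I r)]
    [Fintype K] (X : Tensor I K) {W : ∀ r, Matrix (J r) (I r) ℂ} {r : Fin R}
    {T : Matrix (I r) (I r) ℂ} (h : T * X.unfold r = X.unfold r) (hW : W r * T = 0) :
    kroneckerAll W * X.lastUnfoldT = 0 := by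
  rw [← kroneckerAll_update_one_mul X r h, ← Matrix.mul_assoc, kroneckerAll_mul,
    kroneckerAll_eq_zero (r := r) (by rw [Function.update_self, hW]), Matrix.zero_mul]

theorem lastUnfoldT_modeMul {L : Type} [∀ r, Fintype (I r)] [Fintype K] (X : Tensor I K)
    (U : ∀ r, Matrix (J r) (I r) ℂ) (W : Matrix L K ℂ) :
    (X.modeMul U W).lastUnfoldT = kroneckerAll U * X.lastUnfoldT * Wᵀ := by
  ext j l
  simp only [Tensor.lastUnfoldT, Tensor.modeMul, kroneckerAll, Matrix.mul_apply, Matrix.of_apply,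
    Matrix.transpose_apply, Finset.sum_mul]
  rw [Finset.sum_comm]
  exact Finset.sum_congr rfl fun k _ => Finset.sum_congr rfl fun i _ => by ring

theorem norm_unfold [∀ r, Fintype (I r)] [Fintype K] (X : Tensor I K) (r : Fin R) :
    ‖X.unfold r‖ = ‖X.lastUnfoldT‖ := by
  rw [← sq_eq_sq₀ (norm_nonneg _) (norm_nonneg _), frobenius_norm_sq, frobenius_norm_sq,
    ← (Equiv.piSplitAt r I).symm.sum_comp]
  simp only [Fintype.sum_prod_type]
  rfl

end Kronecker

section KroneckerExpansion

open Asymptotics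

variable {Ω : Type*} {f : Filter Ω} {ε : Ω → ℝ}

theorem prod_expansion {ι : Type*} [DecidableEq ι] (hε : ε =O[f] fun _ => (1 : ℝ)) (s : Finset ι)
    {a : ι → ℂ} {x y : ι → Ω → ℂ} (hy : ∀ r, y r =O[f] ε)
    (hx : ∀ r, (fun ω => x r ω - a r - y r ω) =O[f] fun ω => ε ω ^ 2) :
    (fun ω => ∏ r ∈ s, x r ω - ∏ r ∈ s, a r -
      ∑ r ∈ s, ∏ q ∈ s, if q = r then y q ω else a q) =O[f] fun ω => ε ω ^ 2 := by
  have hsq : (fun ω => ε ω ^ 2) =O[f] ε := by simpa [sq] using (isBigO_refl ε f).mul hε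
  have hxa : ∀ r, (fun ω => x r ω - a r) =O[f] ε := fun r =>
    (((hx r).trans hsq).add (hy r)).congr_left fun ω => by ring
  suffices h : (fun ω => ∏ r ∈ s, x r ω - ∏ r ∈ s, a r -
        ∑ r ∈ s, ∏ q ∈ s, if q = r then y q ω else a q) =O[f] (fun ω => ε ω ^ 2) ∧
      (fun ω => ∑ r ∈ s, ∏ q ∈ s, if q = r then y q ω else a q) =O[f] ε from h.1
  induction s using Finset.induction_on with
  | empty => simp [isBigO_zero]
  | insert r s hr ih =>
    obtain ⟨ih1, ih2⟩ := ih
    have e : ∀ ω, ∑ t ∈ insert r s, ∏ q ∈ insert r s, (if q = t then y q ω else a q) =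
        y r ω * ∏ q ∈ s, a q + a r * ∑ t ∈ s, ∏ q ∈ s, if q = t then y q ω else a q := by
      intro ω
      rw [Finset.sum_insert hr, Finset.prod_insert hr, if_pos rfl, Finset.mul_sum]
      congr 1
      · congr 1
        exact Finset.prod_congr rfl fun q hq => if_neg (by rintro rfl; exact hr hq)
      · refine Finset.sum_congr rfl fun t ht => ?_
        rw [Finset.prod_insert hr, if_neg (by rintro rfl; exact hr ht)]
    have hP : (fun ω => ∏ r ∈ s, x r ω - ∏ r ∈ s, a r) =O[f] ε :=
      ((ih1.trans hsq).add ih2).congr_left fun ω => by ring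
    constructor
    · have h1 := (ih1.const_mul_left (a r)).add ((hx r).mul
        (isBigO_const_one ℝ (∏ r ∈ s, a r) f) |>.congr_right fun ω => mul_one _)
      have h2 := (hxa r).mul hP
      refine (h1.add (h2.congr_right fun ω => (sq (ε ω)).symm)).congr_left fun ω => ?_
      rw [e, Finset.prod_insert hr, Finset.prod_insert hr]
      ring
    · refine IsBigO.congr_left ?_ fun ω => (e ω).symm
      exact ((hy r).mul (isBigO_const_one ℝ (∏ r ∈ s, a r) f) |>.congr_right
        fun ω => mul_one _).add (ih2.const_mul_left _)

theorem kroneckerAll_update_isBigO {R : ℕ} {I J : Fin R → Type} [∀ r, Fintype (I r)]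
    [∀ r, Fintype (J r)] (T : ∀ r, Matrix (I r) (J r) ℂ) {r : Fin R}
    {Y : Ω → Matrix (I r) (J r) ℂ} (hY : Y =O[f] ε) :
    (fun ω => kroneckerAll (Function.update T r (Y ω))) =O[f] ε := by
  refine matrix_isBigO_of_apply fun i j => ?_
  refine ((matrix_isBigO_apply hY (i r) (j r)).mul (isBigO_const_one ℝ
    (∏ s ∈ Finset.univ.erase r, T s (i s) (j s)) f)).congr (fun ω => ?_) fun ω => mul_one _
  rw [kroneckerAll_update_apply]

/-- The product rule for Kronecker products. -/
theorem kroneckerAll_expansion {R : ℕ} {I J : Fin R → Type} [∀ r, Fintype (I r)]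
    [∀ r, Fintype (J r)] (hε : ε =O[f] fun _ => (1 : ℝ)) {T : ∀ r, Matrix (I r) (J r) ℂ}
    {X Y : ∀ r, Ω → Matrix (I r) (J r) ℂ} (hY : ∀ r, Y r =O[f] ε)
    (hX : ∀ r, (fun ω => X r ω - T r - Y r ω) =O[f] fun ω => ε ω ^ 2) :
    (fun ω => kroneckerAll (fun r => X r ω) - kroneckerAll T -
      ∑ r, kroneckerAll (Function.update T r (Y r ω))) =O[f] fun ω => ε ω ^ 2 := by
  refine matrix_isBigO_of_apply fun i j => ?_
  refine (prod_expansion hε Finset.univ (a := fun r => T r (i r) (j r))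
    (fun r => matrix_isBigO_apply (hY r) (i r) (j r))
    (fun r => matrix_isBigO_apply (hX r) (i r) (j r))).congr_left fun ω => ?_
  simp only [kroneckerAll, Matrix.sub_apply, Matrix.of_apply, Matrix.sum_apply]
  congr 1
  refine Finset.sum_congr rfl fun r _ => Finset.prod_congr rfl fun q _ => ?_
  by_cases h : q = r
  · subst h; simp
  · simp [h]

end KroneckerExpansion

/-! ### The HOSVD-based signal subspace estimate -/

namespace HOSVD

variable {R : ℕ} {I : Fin R → Type} {K : Type} [∀ r, Fintype (I r)]
  [∀ r, DecidableEq (I r)] [Fintype K] [DecidableEq K]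
  {X : Tensor I K} {p : Fin R → ℕ} {d : ℕ}

/-- The HOSVD-based estimate is the matrix of dominant left singular vectors, projected in each mode
onto the estimated signal subspace of that mode. -/
theorem lastUnfoldT_subspaceTensor (H : HOSVD X p d) (hpos : ∀ k : Fin d, 0 < H.last.σ k) :
    H.subspaceTensor.lastUnfoldT = kroneckerAll (fun r => (H.mode r).T) * H.last.Us := by
  have hX : X.lastUnfoldT = kroneckerAll (fun r => (H.mode r).U) * H.core.lastUnfoldT *
      H.last.Vᴴ := by
    conv_lhs => rw [H.eq_modeMul]
    rw [lastUnfoldT_modeMul]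
    rfl
  have hcore : kroneckerAll (fun r => (H.mode r).Uᴴ) * X.lastUnfoldT * H.last.V =
      H.core.lastUnfoldT := by
    have h1 : H.last.Vᴴ * H.last.V = 1 := H.last.V_conj_mul
    have h2 : kroneckerAll (fun r => (H.mode r).Uᴴ) * kroneckerAll (fun r => (H.mode r).U) = 1 := by
      rw [kroneckerAll_mul, ← kroneckerAll_one]
      congr 1
      ext1 r
      exact (H.mode r).U_conj_mul
    refine (congrArg (fun M => kroneckerAll (fun r => (H.mode r).Uᴴ) * M * H.last.V) hX).trans ?_
    rw [Matrix.mul_assoc, Matrix.mul_assoc, h1, Matrix.mul_one, ← Matrix.mul_assoc, h2,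
      Matrix.one_mul]
  have htrunc : H.truncCore.lastUnfoldT =
      kroneckerAll (fun r => (H.mode r).Usᴴ) * X.lastUnfoldT * H.last.Vs := by
    ext a k
    exact (congrFun (congrFun hcore fun r => Sum.inl (a r)) (Sum.inl k)).symm
  have hSig : (H.last.Sig⁻¹)ᵀ = H.last.Sig⁻¹ := by
    rw [H.last.Sig_inv hpos, Matrix.diagonal_transpose]
  rw [subspaceTensor, lastUnfoldT_modeMul, htrunc, hSig, Matrix.mul_assoc _ X.lastUnfoldT,
    H.last.mul_Vs, ← Matrix.mul_assoc, kroneckerAll_mul]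
  simp only [Matrix.mul_assoc, H.last.Sig_mul_inv hpos, Matrix.mul_one]
  rfl

end HOSVD

namespace HOSVD

open Asymptotics

variable {R : ℕ} {I : Fin R → Type} {K : Type} [∀ r, Fintype (I r)]
  [∀ r, DecidableEq (I r)] [Fintype K] [DecidableEq K] {p : Fin R → ℕ} {d : ℕ}
  {Ω : Type*} {f : Filter Ω} {ε : Ω → ℝ} {X₀ : Tensor I K} {X : Ω → Tensor I K}

/-- First-order expansion of the HOSVD-based signal subspace estimate. -/
theorem lastUnfoldT_subspaceTensor_expansion {S : SVD X₀.lastUnfoldT d}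
    {Sr : ∀ r, SVD (X₀.unfold r) (p r)} {H : ∀ ω, HOSVD (X ω) p d}
    (h : S.IsPerturbation (fun ω => (H ω).last) f ε)
    (hr : ∀ r, (Sr r).IsPerturbation (fun ω => (H ω).mode r) f ε)
    (hUs : (fun ω => (H ω).last.Us - S.Us) =O[f] ε) :
    (fun ω => ((H ω).subspaceTensor.lastUnfoldT - S.Us) -
      (kroneckerAll (fun r => (Sr r).T) * ((H ω).last.Us - S.Us) +
        ∑ r, kroneckerAll (Function.update (fun s => (Sr s).T) r
          (((Sr r).Un * (Sr r).Γn ((X ω).unfold r - X₀.unfold r)) * (Sr r).Usᴴ)) * S.Us)) =O[f]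
      fun ω => ε ω ^ 2 := by
  let Y : ∀ r, Ω → Matrix (I r) (I r) ℂ := fun r ω =>
    (Sr r).Un * (Sr r).Γn ((X ω).unfold r - X₀.unfold r) * (Sr r).Usᴴ
  have hY : ∀ r, Y r =O[f] ε := fun r =>
    matrix_isBigO_mul_bdd (hr r).Un_mul_Γn_isBigO (matrix_isBigO_const _)
  have hYY : ∀ r, (fun ω => Y r ω + (Y r ω)ᴴ) =O[f] ε := fun r =>
    (hY r).add (matrix_isBigO_conjTranspose (hY r))
  have h1 := matrix_isBigO_mul_bdd (kroneckerAll_expansion h.small hYY fun r => (hr r).T_expansion)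
    h.Us_bdd
  have h2 := matrix_isBigO_mul_sq (IsBigO.fun_sum (s := Finset.univ) fun r _ =>
    kroneckerAll_update_isBigO (fun s => (Sr s).T) (hYY r)) hUs
  refine (h1.add h2).congr_left fun ω => ?_
  have hUs₀ : S.Us = X₀.lastUnfoldT * (S.Vs * S.Sig⁻¹) := by
    rw [← Matrix.mul_assoc, S.mul_Vs, Matrix.mul_assoc,
      S.Sig_mul_inv (S.σ_signal_pos h.rank_eq), Matrix.mul_one]
  have hT : ∀ r, (Sr r).T * X₀.unfold r = X₀.unfold r := fun r => (Sr r).T_mul (hr r).rank_eq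
  have e1 : kroneckerAll (fun r => (Sr r).T) * S.Us = S.Us := by
    rw [hUs₀, ← Matrix.mul_assoc, kroneckerAll_mul_lastUnfoldT _ hT]
  -- The adjoint part of the perturbation of the `r`-mode projection vanishes on the signal subspace
  -- of mode `r`.
  have e2 : ∀ r, kroneckerAll (Function.update (fun s => (Sr s).T) r (Y r ω)ᴴ) * S.Us = 0 := by
    intro r
    rw [hUs₀, ← Matrix.mul_assoc, kroneckerAll_mul_lastUnfoldT_eq_zero X₀ (hT r), Matrix.zero_mul]
    have hQ : (1 - (Sr r).T) * (Sr r).T = 0 := by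
      rw [Matrix.sub_mul, SVD.T_mul_T, Matrix.one_mul, sub_self]
    rw [Function.update_self]
    simp only [Y, SVD.Un_mul_Γn, Matrix.conjTranspose_mul, Matrix.conjTranspose_sub,
      Matrix.conjTranspose_one, SVD.T_conjTranspose, Matrix.mul_assoc, hQ, Matrix.mul_zero]
  have e3 : (∑ r, kroneckerAll (Function.update (fun s => (Sr s).T) r (Y r ω + (Y r ω)ᴴ))) * S.Us =
      ∑ r, kroneckerAll (Function.update (fun s => (Sr s).T) r (Y r ω)) * S.Us := by
    rw [Matrix.sum_mul]
    refine Finset.sum_congr rfl fun r _ => ?_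
    rw [kroneckerAll_update_add, Matrix.add_mul, e2, add_zero]
  rw [(H ω).lastUnfoldT_subspaceTensor (h.pos ω), Matrix.mul_sub _ _ S.Us, Matrix.mul_sub _ _ S.Us,
    e1, e3, Matrix.sub_mul, Matrix.sub_mul]
  abel

end HOSVD

/-! ### Uniformity in the noise and in the decomposition -/

/-- Matrices close to one of rank `p` have their `p` dominant singular values bounded below. -/
theorem SVD.exists_gap {m n : Type} [Fintype m] [Fintype n] [DecidableEq m] [DecidableEq n]
    {A₀ : Matrix m n ℂ} {p : ℕ} (S : SVD A₀ p) (hp : A₀.rank = p) :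
    ∃ δ : ℝ, 0 < δ ∧ ∃ c : ℝ, 0 < c ∧ ∀ A : Matrix m n ℂ, ‖A - A₀‖ ≤ δ →
      ∀ (D : SVD A p) (k : Fin p), c ≤ D.σ k := by
  rcases p with _ | q
  · exact ⟨1, one_pos, 1, one_pos, fun _ _ _ k => k.elim0⟩
  have hs : 0 < S.σ q := S.σ_signal_pos hp (Fin.last q)
  have hA : 0 < 2 * ‖A₀‖ + 1 := by positivity
  refine ⟨min 1 (S.σ q ^ 2 / 2 / (2 * ‖A₀‖ + 1)), by positivity, S.σ q / 2, by positivity,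
    fun A hAδ D k => ?_⟩
  have h1 : ‖A - A₀‖ ≤ 1 := hAδ.trans (min_le_left _ _)
  have h2 : ‖A - A₀‖ * (2 * ‖A₀‖ + 1) ≤ S.σ q ^ 2 / 2 :=
    (le_div_iff₀ hA).1 (hAδ.trans (min_le_right _ _))
  have h3 : ‖A * Aᴴ - A₀ * A₀ᴴ‖ ≤ ‖A - A₀‖ * (2 * ‖A₀‖ + 1) := by
    have e : A * Aᴴ - A₀ * A₀ᴴ = (A - A₀) * Aᴴ + A₀ * (A - A₀)ᴴ := by
      simp [Matrix.sub_mul, Matrix.mul_sub]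
    have hle : ‖A‖ ≤ ‖A₀‖ + 1 := by
      have := norm_add_le (A - A₀) A₀
      rw [sub_add_cancel] at this
      linarith
    calc _ ≤ ‖A - A₀‖ * ‖Aᴴ‖ + ‖A₀‖ * ‖(A - A₀)ᴴ‖ := by
          rw [e]
          exact (norm_add_le _ _).trans (add_le_add (Matrix.frobenius_norm_mul _ _)
            (Matrix.frobenius_norm_mul _ _))
      _ ≤ ‖A - A₀‖ * (‖A₀‖ + 1) + ‖A₀‖ * ‖A - A₀‖ := by
          rw [Matrix.frobenius_norm_conjTranspose, Matrix.frobenius_norm_conjTranspose]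
          gcongr
      _ = _ := by ring
  have h4 := (abs_le.1 (S.abs_sq_sub_sq_le D (Fin.last q))).1
  have h5 : D.σ q ≤ D.σ k := D.σ_antitone (Nat.lt_succ_iff.1 k.2)
  rw [Fin.val_last] at h4
  refine le_trans (le_of_sq_le_sq ?_ (D.σ_nonneg _)) h5
  nlinarith

theorem theorem2 {R : ℕ} (M : Fin R → ℕ) (N d : ℕ)
    -- the noise-free tensor, whose (R+1)-rank is `d`
    (X₀ : Tensor (fun r => Fin (M r)) (Fin N)) (hd : X₀.lastUnfoldT.rank = d)
    -- its SVDs; the nonzero singular values in the last mode are distinct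
    (S₀ : SVD X₀.lastUnfoldT d) (hσ : Function.Injective fun k : Fin d => S₀.σ k)
    (S₀r : ∀ r, SVD (X₀.unfold r) (X₀.modeRank r)) :
    ∃ C δ : ℝ, 0 < δ ∧
      -- for every noise tensor with `Δ = ‖E‖ ≤ δ` and every HOSVD of `X₀ + E`
      ∀ E : Tensor (fun r => Fin (M r)) (Fin N), ‖E.lastUnfoldT‖ ≤ δ →
      ∀ H : HOSVD (X₀ + E) X₀.modeRank d,
        -- the singular vectors in the last mode have their phases aligned with those of `X₀`
        (∀ k : Fin d, ((S₀.Usᴴ * H.last.Us) k k).im = 0 ∧ 0 ≤ ((S₀.Usᴴ * H.last.Us) k k).re) →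
        -- the expansion of `ΔUs = H.last.Us - S₀.Us`
        ‖(H.last.Us - S₀.Us) -
            (S₀.Un * S₀.Γn E.lastUnfoldT + S₀.Us * S₀.Γs E.lastUnfoldT)‖
          ≤ C * ‖E.lastUnfoldT‖ ^ 2 ∧
        -- the expansion of the error of the HOSVD-based estimate; in mode `r` the perturbation is
        -- `ΔU_r = Un_r * Γn_r`
        ‖(H.subspaceTensor.lastUnfoldT - S₀.Us) -
            (kroneckerAll (fun r => (S₀r r).T) * (H.last.Us - S₀.Us) +
              ∑ r, kroneckerAll (Function.update (fun s => (S₀r s).T) r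
                (((S₀r r).Un * (S₀r r).Γn (E.unfold r)) * (S₀r r).Usᴴ)) * S₀.Us)‖
          ≤ C * ‖E.lastUnfoldT‖ ^ 2 := by
  obtain ⟨δ₀, hδ₀, c₀, hc₀, hgap₀⟩ := S₀.exists_gap hd
  choose δr hδr cr hcr hgapr using fun r => (S₀r r).exists_gap rfl
  obtain ⟨δ, hδ, hδ1, hδ2⟩ : ∃ δ : ℝ, 0 < δ ∧ δ ≤ δ₀ ∧ ∀ r, δ ≤ δr r := by
    have h : ∀ᶠ δ : ℝ in nhdsWithin 0 (Set.Ioi 0), 0 < δ ∧ δ ≤ δ₀ ∧ ∀ r, δ ≤ δr r :=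
      (eventually_mem_nhdsWithin (s := Set.Ioi 0)).and (((eventually_le_nhds hδ₀).and
        (Filter.eventually_all.2 fun r => eventually_le_nhds (hδr r))).filter_mono
          nhdsWithin_le_nhds)
    exact h.exists
  -- The family of all admissible noise tensors and decompositions: a bound `O(·)` along `⊤` is a
  -- bound by one constant for the whole family.
  let Ω := {ω : Σ E : Tensor (fun r => Fin (M r)) (Fin N), HOSVD (X₀ + E) X₀.modeRank d //
    ‖ω.1.lastUnfoldT‖ ≤ δ ∧ ∀ k : Fin d,
      ((S₀.Usᴴ * ω.2.last.Us) k k).im = 0 ∧ 0 ≤ ((S₀.Usᴴ * ω.2.last.Us) k k).re}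
  let ε : Ω → ℝ := fun ω => ‖ω.1.1.lastUnfoldT‖
  have hsmall : ε =O[⊤] fun _ => (1 : ℝ) :=
    Asymptotics.isBigO_top.2 ⟨δ, fun ω => by simpa [ε] using ω.2.1⟩
  have e0 : ∀ E : Tensor (fun r => Fin (M r)) (Fin N),
      (X₀ + E).lastUnfoldT - X₀.lastUnfoldT = E.lastUnfoldT := fun E =>
    add_sub_cancel_left X₀.lastUnfoldT E.lastUnfoldT
  have er : ∀ (E : Tensor (fun r => Fin (M r)) (Fin N)) (r : Fin R),
      (X₀ + E).unfold r - X₀.unfold r = E.unfold r := fun E r =>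
    add_sub_cancel_left (X₀.unfold r) (E.unfold r)
  have hP₀ : S₀.IsPerturbation (fun ω : Ω => ω.1.2.last) ⊤ ε :=
    { rank_eq := hd
      error := Asymptotics.isBigO_of_le _ fun ω => by simp [e0, ε]
      small := hsmall
      gap := ⟨c₀, hc₀, fun ω k => hgap₀ _ (by rw [e0]; exact ω.2.1.trans hδ1) _ k⟩ }
  have hPr : ∀ r, (S₀r r).IsPerturbation (fun ω : Ω => ω.1.2.mode r) ⊤ ε := fun r =>
    { rank_eq := rfl
      error := Asymptotics.isBigO_of_le _ fun ω => by simp [er, norm_unfold, ε]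
      small := hsmall
      gap := ⟨cr r, hcr r, fun ω k => hgapr r _
        (by rw [er, norm_unfold]; exact ω.2.1.trans (hδ2 r)) _ k⟩ }
  have hph := fun ω : Ω => ω.2.2
  obtain ⟨C₁, hC₁⟩ := Asymptotics.isBigO_top.1 (hP₀.Us_expansion hσ hph)
  obtain ⟨C₂, hC₂⟩ := Asymptotics.isBigO_top.1
    (HOSVD.lastUnfoldT_subspaceTensor_expansion hP₀ hPr (hP₀.Us_error hσ hph))
  refine ⟨max C₁ C₂, δ, hδ, fun E hE H hH => ⟨?_, ?_⟩⟩
  · have := hC₁ ⟨⟨E, H⟩, hE, hH⟩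
    simp only [e0] at this
    refine this.trans ?_
    rw [Real.norm_of_nonneg (sq_nonneg _)]
    exact mul_le_mul_of_nonneg_right (le_max_left _ _) (sq_nonneg _)
  · have := hC₂ ⟨⟨E, H⟩, hE, hH⟩
    simp only [er] at this
    refine this.trans ?_
    rw [Real.norm_of_nonneg (sq_nonneg _)]
    exact mul_le_mul_of_nonneg_right (le_max_right _ _) (sq_nonneg _)
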